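/- For each sample size $N$ let $K=K_N\ge 0$, $L=L_N\ge 1$, $M=M_N\ge 1$ be integers, $\beta\in\mathbb R^K$ deterministic, and $Y=\mu+e$, $\mu=X\beta$, with a random $N\times K$ design matrix $X$ and errors $e=(e_1,\dots,e_N)^\top$ that are conditionally independent given $X$, with $E(e_i\mid X)=0$ and $E(e_i^2\mid X)=\sigma^2$, where $\sigma$ does not depend on $N$ and $i$. Let $R=\{R_m^{(\ell)}:1\le m\le M,\,1\le \ell\le L\}$ be random diagonal $K\times K$ matrices with diagonal entries in $\{0,1\}$ (the selection matrices), conditionally independent of $e$ given $X$. For a matrix $A$ put $P_A=A(A^\top A)^-A^\top$, where $^-$ is the Moore–Penrose inverse, and let $k_m^{(\ell)}=\operatorname{trace}(P_{XR_m^{(\ell)}})$ and $H_n=\{w\in[0,1]^n:\sum_j w_j=1\}$. Let $\hat w^{(\ell)}\in\mathbb R^M$ $(\ell=1,\dots,L)$ be (possibly data-dependent) random first-round weights with $\sum_m\hat w^{(\ell)}_m=1$, and let $w^{(\ell)}\in H_M$ be weights that do not depend on $Y$ (deterministic, or measurable functions of $(X,R)$). For $\mathbb w\in H_L$ define $$\hat\mu_{RSA}(\mathbb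 w)=\sum_{\ell=1}^L\mathbb w_\ell\sum_{m=1}^M\hat w_m^{(\ell)}P_{XR_m^{(\ell)}}Y,\qquad \tilde\mu_{RSA}(\mathbb w)=\sum_{\ell=1}^L\mathbb w_\ell\sum_{m=1}^M w_m^{(\ell)}P_{XR_m^{(\ell)}}Y,$$ $\mathcal L_N(\mathbb w)=\|\hat\mu_{RSA}(\mathbb w)-\mu\|^2$, $\tilde{\mathcal R}_N(\mathbb w)=E[\|\tilde\mu_{RSA}(\mathbb w)-\mu\|^2\mid X,R]$ and $\xi_N=\inf_{\mathbb w\in H_L}\tilde{\mathcal R}_N(\mathbb w)$. Let $\hat{\mathbb w}$ be a minimizer over $\mathbb w\in H_L$ of the Mallows criterion $$\|Y-\hat\mu_{RSA}(\mathbb w)\|^2+2\sigma^2\sum_{\ell=1}^L\mathbb w_\ell\sum_{m=1}^M\hat w_m^{(\ell)}k_m^{(\ell)}.$$ Let $r_{N,M}$ be real numbers, and assume that, as $N\to\infty$, 1. there is a constant $C$ with $E(e_i^4\mid X)\le C$ almost surely for all $N$ and $i$, and $\|\mu\|^2=O(N)$ almost surely; 2. almost surely, $E[\|\hat w^{(\ell)}-w^{(\ell)}\|^4\mid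 X,R]=O(r_{N,M}^4)$ uniformly in $\ell=1,\dots,L$; 3. almost surely, $\xi_N>0$ for all large $N$, $\xi_N^{-1}r_{N,M}^2LMN\to0$, $\xi_N^{-1}r_{N,M}L\sqrt{MN}\to0$ and $\xi_N^{-1}L^2\to0$. Then $$\frac{\mathcal L_N(\hat{\mathbb w})}{\inf_{\mathbb w\in H_L}\mathcal L_N(\mathbb w)}\longrightarrow 1\quad\text{in probability}.$$ -/

import Mathlib

open MeasureTheory ProbabilityTheory Filter Asymptotics Matrix
open scoped Topology ENNReal Matrix

/-! ### The Moore-Penrose inverse of a real matrix -/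

/-- `G` is a Moore-Penrose inverse of the real matrix `A`: the four Penrose equations. -/
def IsMoorePenrose {m n : Type*} [Fintype m] [Fintype n]
    (A : Matrix m n ℝ) (G : Matrix n m ℝ) : Prop :=
  A * G * A = A ∧ G * A * G = G ∧ (A * G)ᵀ = A * G ∧ (G * A)ᵀ = G * A

theorem IsMoorePenrose.unique {m n : Type*} [Fintype m] [Fintype n]
    {A : Matrix m n ℝ} {G H : Matrix n m ℝ}
    (hG : IsMoorePenrose A G) (hH : IsMoorePenrose A H) : G = H := by
  obtain ⟨g1, g2, g3, g4⟩ := hG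
  obtain ⟨h1, h2, h3, h4⟩ := hH
  have e1 : A * G = A * H := by
    calc A * G = (A * G)ᵀ := g3.symm
      _ = ((A * H) * (A * G))ᵀ := by rw [← Matrix.mul_assoc, h1]
      _ = (A * G) * (A * H) := by rw [Matrix.transpose_mul, g3, h3]
      _ = A * H := by rw [← Matrix.mul_assoc, g1]
  have e2 : G * A = H * A := by
    calc G * A = (G * A)ᵀ := g4.symm
      _ = ((G * A) * (H * A))ᵀ := by rw [Matrix.mul_assoc, ← Matrix.mul_assoc A, h1]
      _ = (H * A) * (G * A) := by rw [Matrix.transpose_mul, g4, h4]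
      _ = H * A := by rw [Matrix.mul_assoc, ← Matrix.mul_assoc A, g1]
  calc G = G * A * G := g2.symm
    _ = H * (A * G) := by rw [e2, Matrix.mul_assoc]
    _ = H * A * H := by rw [e1, Matrix.mul_assoc]
    _ = H := h2

theorem exists_isMoorePenrose {m n : Type*} [Fintype m] [Fintype n]
    (A : Matrix m n ℝ) : ∃ G : Matrix n m ℝ, IsMoorePenrose A G := by
  classical
  have hS : (Aᵀ * A).IsHermitian := by
    simpa [Matrix.conjTranspose_eq_transpose_of_trivial] using
      Matrix.isHermitian_conjTranspose_mul_self A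
  obtain ⟨U, d, hU, hdec⟩ : ∃ (U : Matrix n n ℝ) (d : n → ℝ), Uᵀ * U = 1 ∧
      Aᵀ * A = U * diagonal d * Uᵀ := by
    refine ⟨hS.eigenvectorUnitary, hS.eigenvalues, ?_, ?_⟩
    · have := Unitary.coe_star_mul_self hS.eigenvectorUnitary
      simpa [Matrix.star_eq_conjTranspose,
        Matrix.conjTranspose_eq_transpose_of_trivial] using this
    · have := hS.spectral_theorem
      rw [Unitary.conjStarAlgAut_apply] at this
      simpa [Matrix.star_eq_conjTranspose,
        Matrix.conjTranspose_eq_transpose_of_trivial, Function.comp_def] using this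
  have hmul : ∀ a b : n → ℝ, (U * diagonal a * Uᵀ) * (U * diagonal b * Uᵀ)
      = U * diagonal (fun i => a i * b i) * Uᵀ := by
    intro a b
    calc (U * diagonal a * Uᵀ) * (U * diagonal b * Uᵀ)
        = U * diagonal a * (Uᵀ * U) * diagonal b * Uᵀ := by simp only [Matrix.mul_assoc]
      _ = _ := by
        rw [hU, Matrix.mul_one, Matrix.mul_assoc U, Matrix.diagonal_mul_diagonal]
  have htr : ∀ a : n → ℝ, (U * diagonal a * Uᵀ)ᵀ = U * diagonal a * Uᵀ := by
    intro a
    simp [Matrix.transpose_mul, Matrix.mul_assoc]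
  set G₀ : Matrix n n ℝ := U * diagonal (fun i => (d i)⁻¹) * Uᵀ with hG₀
  have p1 : (Aᵀ * A) * G₀ * (Aᵀ * A) = Aᵀ * A := by
    rw [hdec, hG₀, hmul, hmul]
    congr 3
    funext i
    exact mul_inv_mul_cancel (d i)
  have p2 : G₀ * (Aᵀ * A) * G₀ = G₀ := by
    rw [hdec, hG₀, hmul, hmul]
    congr 3
    funext i
    simpa using mul_inv_mul_cancel (d i)⁻¹
  have p3 : (G₀ * (Aᵀ * A))ᵀ = G₀ * (Aᵀ * A) := by
    rw [hdec, hG₀, hmul, htr]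
  have p4 : G₀ᵀ = G₀ := htr _
  refine ⟨G₀ * Aᵀ, ?_, ?_, ?_, ?_⟩
  · have hE : Aᵀ * (A * (G₀ * Aᵀ) * A - A) = 0 := by
      rw [Matrix.mul_sub, sub_eq_zero]
      simpa only [Matrix.mul_assoc] using p1
    have hEE : (A * (G₀ * Aᵀ) * A - A)ᵀ * (A * (G₀ * Aᵀ) * A - A) = 0 := by
      have hf : A * (G₀ * Aᵀ) * A - A = A * (G₀ * Aᵀ * A - 1) := by
        rw [Matrix.mul_sub, Matrix.mul_one]
        simp only [Matrix.mul_assoc]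
      calc (A * (G₀ * Aᵀ) * A - A)ᵀ * (A * (G₀ * Aᵀ) * A - A)
          = (G₀ * Aᵀ * A - 1)ᵀ * (Aᵀ * (A * (G₀ * Aᵀ) * A - A)) := by
            conv_lhs => rw [hf, Matrix.transpose_mul, Matrix.mul_assoc, ← hf]
        _ = 0 := by rw [hE, Matrix.mul_zero]
    have h0 : A * (G₀ * Aᵀ) * A - A = 0 := by
      rw [← Matrix.conjTranspose_mul_self_eq_zero,
        Matrix.conjTranspose_eq_transpose_of_trivial]
      exact hEE
    exact sub_eq_zero.mp h0
  · calc G₀ * Aᵀ * A * (G₀ * Aᵀ) = G₀ * (Aᵀ * A) * G₀ * Aᵀ := by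
          simp only [Matrix.mul_assoc]
      _ = G₀ * Aᵀ := by rw [p2]
  · simp [Matrix.transpose_mul, p4, Matrix.mul_assoc]
  · simpa only [Matrix.mul_assoc] using p3

/-- The Moore-Penrose generalized inverse `A⁻` of a real matrix. -/
noncomputable def pinv {m n : Type*} [Fintype m] [Fintype n]
    (A : Matrix m n ℝ) : Matrix n m ℝ :=
  Classical.choose (exists_isMoorePenrose A)

theorem pinv_spec {m n : Type*} [Fintype m] [Fintype n] (A : Matrix m n ℝ) :
    IsMoorePenrose A (pinv A) :=
  Classical.choose_spec (exists_isMoorePenrose A)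

/-- `P_A = A (Aᵀ A)⁻ Aᵀ`. -/
noncomputable def projMat {m n : Type*} [Fintype m] [Fintype n]
    (A : Matrix m n ℝ) : Matrix m m ℝ :=
  A * pinv (Aᵀ * A) * Aᵀ

/-! ### The random subset averaging (RSA) estimator

`N` is the sample size, `K` the number of covariates, `L` the number of groups and `M` the number
of candidate models in each group. A design is given by the covariates `X : Fin N → Fin K → ℝ`
and the selection indicators `S : Fin L → Fin M → Fin K → Bool`. -/

/-- The squared Euclidean norm `vᵀ v`. -/
def sqNorm {n : ℕ} (v : Fin n → ℝ) : ℝ := v ⬝ᵥ v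

/-- The selection matrix `R = diag(r₁, …, r_K)` with `r_j ∈ {0, 1}`. -/
def selMat {K : ℕ} (s : Fin K → Bool) : Matrix (Fin K) (Fin K) ℝ :=
  Matrix.diagonal fun j => if s j then 1 else 0

/-- `P_{XR}`, for the candidate model that selects the covariates `s`. -/
noncomputable def modelProj {N K : ℕ} (X : Fin N → Fin K → ℝ) (s : Fin K → Bool) :
    Matrix (Fin N) (Fin N) ℝ :=
  projMat (Matrix.of X * selMat s)

/-- The effective dimension of a candidate model: the trace of `P_{XR}`. -/
noncomputable def modelDim {N K : ℕ} (X : Fin N → Fin K → ℝ) (s : Fin K → Bool) : ℝ :=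
  (modelProj X s).trace

/-- The regression mean `μ = X β`. -/
def regMean {N K : ℕ} (X : Fin N → Fin K → ℝ) (β : Fin K → ℝ) : Fin N → ℝ :=
  Matrix.of X *ᵥ β

/-- The estimator with first-round weights `v` and second-round weights `w`:
`∑_ℓ w_ℓ ∑_m v_m^{(ℓ)} P_{X R_m^{(ℓ)}} Y`. -/
noncomputable def rsaFit {N K L M : ℕ} (X : Fin N → Fin K → ℝ) (S : Fin L → Fin M → Fin K → Bool)
    (v : Fin L → Fin M → ℝ) (Y : Fin N → ℝ) (w : Fin L → ℝ) : Fin N → ℝ :=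
  ∑ l, w l • ∑ m, v l m • (modelProj X (S l m) *ᵥ Y)

/-- The squared loss `(μ̂(w) - μ)ᵀ (μ̂(w) - μ)`, for `Y = X β + ε`. -/
noncomputable def rsaLoss {N K L M : ℕ} (X : Fin N → Fin K → ℝ) (S : Fin L → Fin M → Fin K → Bool)
    (v : Fin L → Fin M → ℝ) (β : Fin K → ℝ) (ε : Fin N → ℝ) (w : Fin L → ℝ) : ℝ :=
  sqNorm (rsaFit X S v (regMean X β + ε) w - regMean X β)

/-- The second-round Mallows criterion
`‖Y - ∑_ℓ w_ℓ μ̂^{(ℓ)}‖² + 2 σ² ∑_ℓ w_ℓ k^{(ℓ)}`, with `k^{(ℓ)} = ∑_m v_m^{(ℓ)} k_m^{(ℓ)}`. -/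
noncomputable def rsaMallows {N K L M : ℕ} (σ : ℝ) (X : Fin N → Fin K → ℝ)
    (S : Fin L → Fin M → Fin K → Bool) (v : Fin L → Fin M → ℝ) (Y : Fin N → ℝ)
    (w : Fin L → ℝ) : ℝ :=
  sqNorm (Y - rsaFit X S v Y w) + 2 * σ ^ 2 * ∑ l, w l * ∑ m, v l m * modelDim X (S l m)

/-- The σ-algebra generated by the covariates and all the selection matrices, `σ(X, R)`. -/
abbrev designAlg {Ω : Type*} {N K L M : ℕ} (X : Ω → Fin N → Fin K → ℝ)
    (S : Ω → Fin L → Fin M → Fin K → Bool) : MeasurableSpace Ω :=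
  MeasurableSpace.comap (fun ω => (X ω, S ω)) inferInstance

/-- The conditional risk `R̃(w) = E[L̃(w) | X, R]` of the estimator with limiting first-round
weights `v` (computed with the regular conditional probability given `σ(X, R)`, so that it is
defined for all `w` simultaneously). -/
noncomputable def condRisk {Ω : Type*} [MeasurableSpace Ω] [StandardBorelSpace Ω]
    (P : Measure Ω) [IsFiniteMeasure P] {N K L M : ℕ} (X : Ω → Fin N → Fin K → ℝ)
    (S : Ω → Fin L → Fin M → Fin K → Bool) (v : Ω → Fin L → Fin M → ℝ) (β : Fin K → ℝ)
    (ε : Ω → Fin N → ℝ) (w : Fin L → ℝ) (ω : Ω) : ℝ :=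
  ∫ ω', rsaLoss (X ω') (S ω') (v ω') β (ε ω') w ∂(condExpKernel P (designAlg X S) ω)

/-- The minimal conditional risk `ξ = inf_{w ∈ H_L} R̃(w)`. -/
noncomputable def minCondRisk {Ω : Type*} [MeasurableSpace Ω] [StandardBorelSpace Ω]
    (P : Measure Ω) [IsFiniteMeasure P] {N K L M : ℕ} (X : Ω → Fin N → Fin K → ℝ)
    (S : Ω → Fin L → Fin M → Fin K → Bool) (v : Ω → Fin L → Fin M → ℝ) (β : Fin K → ℝ)
    (ε : Ω → Fin N → ℝ) (ω : Ω) : ℝ :=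
  ⨅ w : stdSimplex ℝ (Fin L), condRisk P X S v β ε w.1 ω

/-!
Fix the design `(X, R)`. Write `P(w)` for the average of the model projections with the non-random
first-round weights, `μ` for the mean and `e` for the errors, and let
`R(w) = ‖μ - P(w) μ‖² + σ² ‖P(w)‖_F²`. The conditional risk of the statement is almost surely equal
to `R(w)`, for all `w` at once (`ae_minCondRisk_eq`).

The loss differs from `R(w)`, and the Mallows criterion minus `‖e‖²` differs from the loss, by

* linear forms in `e` with coefficient vectors `μ - P(w) μ` and `P(w) (μ - P(w) μ)`,
* centred quadratic forms `eᵀ B e - σ² tr B` with `B = P(w)` and `B = P(w)²`,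
* terms that contain the deviations of the first-round weights.

Uniformity in `w` comes from one observation: as `w` varies, the coefficients of the linear and of
the quadratic forms stay in a fixed space of dimension at most `L` or `L²`. So each form is at most
the norm of its coefficient, which is `O(√R(w))` because `P(w)` is a contraction (for `σ = 0` the
errors vanish, and so do the quadratic forms), times the norm of
the projection of the noise (`e`, or the vector of all `e_i e_j - σ² 1_{i = j}`) to that space
(`dotProduct_mulVec_sq_le_spanEnergy`). The squared norm of the projected noise has mean at most a
constant times the dimension (`SecondMomentLe.meanLe_spanEnergy`), hence it is negligible against
the minimal risk `ξ` as soon as `L² / ξ → 0`. The terms with weight deviations are bounded by the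
Cauchy-Schwarz inequality (`meanLe_weightCross`, `meanLe_sqrt_weightFit`) and account for the two
other rates. On the event that all these remainders are small relative to `ξ`, a minimizer of the
criterion nearly minimizes the loss (`abs_loss_ratio_sub_one_le`).

On the probabilistic side, conditioning on `(X, R)` gives the errors the same moments as
conditioning on `X`, because `R` and `e` are conditionally independent
(`CondErrors.ae_whiteNoise`). The conditional mean of the remainder given the design then tends to
zero almost surely (`meanLe_relRemainder`), and conditional Markov bounds together with dominated
convergence turn this into convergence in probability (`tendsto_measure_of_condExpKernel`). This
last step needs measurability of the remainder in the design, in particular of the Moore-Penrose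
inverse (`measurable_pinv`).
-/

/-! ### Orthogonal projections and Frobenius norms -/

section LinearAlgebra

variable {m n k : Type*} [Fintype m] [Fintype n] [Fintype k]

/-- The squared Frobenius norm of a real matrix. -/
def frobSq (B : Matrix m n ℝ) : ℝ := ∑ i, ∑ j, B i j ^ 2

theorem frobSq_nonneg (B : Matrix m n ℝ) : 0 ≤ frobSq B :=
  Finset.sum_nonneg fun _ _ => Finset.sum_nonneg fun _ _ => sq_nonneg _

theorem dotProduct_self_nonneg_real (v : n → ℝ) : 0 ≤ v ⬝ᵥ v :=
  Finset.sum_nonneg fun i _ => mul_self_nonneg (v i)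

theorem dotProduct_sq_le (v w : n → ℝ) : (v ⬝ᵥ w) ^ 2 ≤ (v ⬝ᵥ v) * (w ⬝ᵥ w) := by
  have h := Finset.sum_mul_sq_le_sq_mul_sq Finset.univ v w
  simpa only [dotProduct, sq] using h

/-- Two-parameter Cauchy-Schwarz for a weighted sum of vectors. -/
theorem dotProduct_self_sum_smul_le {κ : Type*} [Fintype κ] (c f g : κ → ℝ) (x : κ → n → ℝ)
    (hf : ∀ a, 0 ≤ f a) (hg : ∀ a, 0 ≤ g a) (h : ∀ a, c a ^ 2 ≤ f a * g a) :
    (∑ a, c a • x a) ⬝ᵥ (∑ a, c a • x a) ≤ (∑ a, f a) * ∑ a, g a * (x a ⬝ᵥ x a) := by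
  have key : ∀ i, (∑ a, c a * x a i) ^ 2 ≤ (∑ a, f a) * ∑ a, g a * x a i ^ 2 := by
    intro i
    refine Finset.sum_sq_le_sum_mul_sum_of_sq_le_mul _ (fun a _ => hf a)
      (fun a _ => mul_nonneg (hg a) (sq_nonneg _)) fun a _ => ?_
    rw [mul_pow, ← mul_assoc]
    exact mul_le_mul_of_nonneg_right (h a) (sq_nonneg _)
  calc (∑ a, c a • x a) ⬝ᵥ (∑ a, c a • x a) = ∑ i, (∑ a, c a * x a i) ^ 2 := by
        simp [dotProduct, Finset.sum_apply, sq]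
    _ ≤ ∑ i, (∑ a, f a) * ∑ a, g a * x a i ^ 2 := Finset.sum_le_sum fun i _ => key i
    _ = _ := by
        rw [← Finset.mul_sum, Finset.sum_comm]
        simp only [dotProduct, Finset.mul_sum, sq]

/-- `B` does not increase the Euclidean norm. -/
def IsContraction (B : Matrix m n ℝ) : Prop :=
  ∀ v : n → ℝ, (B *ᵥ v) ⬝ᵥ (B *ᵥ v) ≤ v ⬝ᵥ v

theorem IsContraction.sum_smul {κ : Type*} [Fintype κ] {c : κ → ℝ} {B : κ → Matrix m n ℝ}
    (hc : c ∈ stdSimplex ℝ κ) (hB : ∀ a, IsContraction (B a)) :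
    IsContraction (∑ a, c a • B a) := by
  intro v
  have h := dotProduct_self_sum_smul_le c c c (fun a => B a *ᵥ v) hc.1 hc.1
    (fun a => (sq (c a)).le)
  rw [hc.2, one_mul] at h
  rw [Matrix.sum_mulVec]
  simp only [Matrix.smul_mulVec]
  refine h.trans ?_
  calc ∑ a, c a * ((B a *ᵥ v) ⬝ᵥ (B a *ᵥ v)) ≤ ∑ a, c a * (v ⬝ᵥ v) :=
        Finset.sum_le_sum fun a _ => mul_le_mul_of_nonneg_left (hB a v) (hc.1 a)
    _ = v ⬝ᵥ v := by rw [← Finset.sum_mul, hc.2, one_mul]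

theorem frobSq_eq_sum_col (B : Matrix m n ℝ) :
    frobSq B = ∑ j, (fun i => B i j) ⬝ᵥ (fun i => B i j) := by
  rw [frobSq, Finset.sum_comm]
  simp only [dotProduct, sq]

theorem IsContraction.frobSq_mul_le {B : Matrix m n ℝ} (hB : IsContraction B)
    (C : Matrix n k ℝ) : frobSq (B * C) ≤ frobSq C := by
  rw [frobSq_eq_sum_col, frobSq_eq_sum_col]
  exact Finset.sum_le_sum fun j _ => hB fun i => C i j

theorem dotProduct_mulVec_of_symm {B : Matrix n n ℝ} (hB : Bᵀ = B) (v w : n → ℝ) :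
    v ⬝ᵥ B *ᵥ w = (B *ᵥ v) ⬝ᵥ w := by
  rw [Matrix.dotProduct_mulVec, ← Matrix.mulVec_transpose, hB]

theorem frobSq_of_symm_idem {B : Matrix n n ℝ} (hB : Bᵀ = B) (hBB : B * B = B) :
    frobSq B = B.trace := by
  conv_rhs => rw [← hBB]
  simp only [frobSq, Matrix.trace, Matrix.diag, Matrix.mul_apply]
  refine Finset.sum_congr rfl fun i _ => Finset.sum_congr rfl fun j _ => ?_
  have : B j i = B i j := by conv_lhs => rw [← hB, Matrix.transpose_apply]
  rw [this, sq]

theorem trace_le_card_of_symm_idem {B : Matrix n n ℝ} (hB : Bᵀ = B) (hBB : B * B = B) :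
    B.trace ≤ Fintype.card n := by
  have h : ∀ i, B i i ≤ 1 := by
    intro i
    have h1 : B i i = ∑ j, B i j ^ 2 := by
      conv_lhs => rw [← hBB, Matrix.mul_apply]
      refine Finset.sum_congr rfl fun j _ => ?_
      have : B j i = B i j := by conv_lhs => rw [← hB, Matrix.transpose_apply]
      rw [this, sq]
    have h2 : B i i ^ 2 ≤ ∑ j, B i j ^ 2 :=
      Finset.single_le_sum (f := fun j => B i j ^ 2) (fun j _ => sq_nonneg _) (Finset.mem_univ i)
    nlinarith
  calc B.trace = ∑ i, B i i := rfl
    _ ≤ ∑ _i : n, (1 : ℝ) := Finset.sum_le_sum fun i _ => h i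
    _ = _ := by simp

theorem isContraction_of_symm_idem {B : Matrix n n ℝ} (hB : Bᵀ = B) (hBB : B * B = B) :
    IsContraction B := by
  intro v
  have h1 : v ⬝ᵥ (B *ᵥ v) = (B *ᵥ v) ⬝ᵥ (B *ᵥ v) := by
    rw [← dotProduct_mulVec_of_symm hB, Matrix.mulVec_mulVec, hBB]
  have h2 := dotProduct_self_nonneg_real (v - B *ᵥ v)
  rw [sub_dotProduct, dotProduct_sub, dotProduct_sub, dotProduct_comm (B *ᵥ v) v, h1] at h2
  linarith

theorem pinv_transpose_of_symm {A : Matrix n n ℝ} (hA : Aᵀ = A) : (pinv A)ᵀ = pinv A := by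
  obtain ⟨h1, h2, h3, h4⟩ := pinv_spec A
  refine IsMoorePenrose.unique (A := A) ⟨?_, ?_, ?_, ?_⟩ (pinv_spec A)
  · have := congrArg Matrix.transpose h1
    simpa [Matrix.transpose_mul, hA, Matrix.mul_assoc] using this
  · have := congrArg Matrix.transpose h2
    simpa [Matrix.transpose_mul, hA, Matrix.mul_assoc] using this
  · rw [Matrix.transpose_mul, Matrix.transpose_transpose, hA, ← h4, Matrix.transpose_mul, hA]
  · rw [Matrix.transpose_mul, Matrix.transpose_transpose, hA, ← h3, Matrix.transpose_mul, hA]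

theorem projMat_transpose (A : Matrix m n ℝ) : (projMat A)ᵀ = projMat A := by
  have h : (Aᵀ * A)ᵀ = Aᵀ * A := by rw [Matrix.transpose_mul, Matrix.transpose_transpose]
  simp only [projMat, Matrix.transpose_mul, Matrix.transpose_transpose,
    pinv_transpose_of_symm h, Matrix.mul_assoc]

theorem projMat_mul_projMat (A : Matrix m n ℝ) : projMat A * projMat A = projMat A := by
  have h := (pinv_spec (Aᵀ * A)).2.1
  calc projMat A * projMat A = A * (pinv (Aᵀ * A) * (Aᵀ * A) * pinv (Aᵀ * A)) * Aᵀ := by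
        simp only [projMat, Matrix.mul_assoc]
    _ = projMat A := by rw [h, projMat]

theorem projMat_mul_self [DecidableEq n] (A : Matrix m n ℝ) : projMat A * A = A := by
  obtain ⟨h1, -, -, -⟩ := pinv_spec (Aᵀ * A)
  set G := pinv (Aᵀ * A)
  have hf : projMat A * A - A = A * (G * (Aᵀ * A) - 1) := by
    rw [Matrix.mul_sub, Matrix.mul_one, projMat]
    simp only [Matrix.mul_assoc, G]
  have h0 : (projMat A * A - A)ᵀ * (projMat A * A - A) = 0 := by
    rw [hf, Matrix.transpose_mul]
    calc (G * (Aᵀ * A) - 1)ᵀ * Aᵀ * (A * (G * (Aᵀ * A) - 1))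
        = (G * (Aᵀ * A) - 1)ᵀ * ((Aᵀ * A) * G * (Aᵀ * A) - Aᵀ * A) := by
          simp only [Matrix.mul_assoc, Matrix.mul_sub, Matrix.mul_one]
      _ = 0 := by rw [h1, sub_self, Matrix.mul_zero]
  rw [← Matrix.conjTranspose_eq_transpose_of_trivial, Matrix.conjTranspose_mul_self_eq_zero] at h0
  exact sub_eq_zero.mp h0

theorem trace_projMat_le (A : Matrix m n ℝ) : (projMat A).trace ≤ Fintype.card n := by
  obtain ⟨-, h2, -, h4⟩ := pinv_spec (Aᵀ * A)
  have : (projMat A).trace = (pinv (Aᵀ * A) * (Aᵀ * A)).trace := by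
    rw [projMat, Matrix.mul_assoc, Matrix.trace_mul_comm, Matrix.mul_assoc]
  rw [this]
  refine trace_le_card_of_symm_idem h4 ?_
  rw [← Matrix.mul_assoc, h2]

theorem isContraction_projMat (A : Matrix m n ℝ) : IsContraction (projMat A) :=
  isContraction_of_symm_idem (projMat_transpose A) (projMat_mul_projMat A)

theorem frobSq_projMat_le (A : Matrix m n ℝ) : frobSq (projMat A) ≤ Fintype.card m := by
  rw [frobSq_of_symm_idem (projMat_transpose A) (projMat_mul_projMat A)]
  exact trace_le_card_of_symm_idem (projMat_transpose A) (projMat_mul_projMat A)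

/-- The squared norm of the orthogonal projection of `z` to the column space of `F`. -/
noncomputable def spanEnergy (F : Matrix m n ℝ) (z : m → ℝ) : ℝ :=
  (projMat F *ᵥ z) ⬝ᵥ (projMat F *ᵥ z)

theorem spanEnergy_nonneg (F : Matrix m n ℝ) (z : m → ℝ) : 0 ≤ spanEnergy F z :=
  dotProduct_self_nonneg_real _

/-- A linear form `⟨z, F c⟩` is bounded, uniformly in the coefficients `c`, by the norm of `F c`
times the norm of the projection of `z` to the column space. -/
theorem dotProduct_mulVec_sq_le_spanEnergy (F : Matrix m n ℝ) (z : m → ℝ) (c : n → ℝ) :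
    (z ⬝ᵥ F *ᵥ c) ^ 2 ≤ spanEnergy F z * ((F *ᵥ c) ⬝ᵥ (F *ᵥ c)) := by
  classical
  have h : z ⬝ᵥ F *ᵥ c = (projMat F *ᵥ z) ⬝ᵥ (F *ᵥ c) := by
    rw [← dotProduct_mulVec_of_symm (projMat_transpose F), Matrix.mulVec_mulVec, projMat_mul_self]
  rw [h]
  exact dotProduct_sq_le _ _

end LinearAlgebra

section QuadraticForm

variable {n : Type*} [Fintype n]

/-- The centred products `e_i e_j - σ² 1_{i = j}` of the errors, as a vector indexed by pairs. -/
def centeredProd [DecidableEq n] (σ : ℝ) (e : n → ℝ) (p : n × n) : ℝ :=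
  e p.1 * e p.2 - if p.1 = p.2 then σ ^ 2 else 0

/-- The matrix whose columns are the vectorized matrices `B k`. -/
def vecColumns {κ : Type*} (B : κ → Matrix n n ℝ) : Matrix (n × n) κ ℝ :=
  Matrix.of fun p k => B k p.1 p.2

/-- The centred quadratic form `eᵀ B e - σ² tr B`. -/
def centeredQuad (σ : ℝ) (e : n → ℝ) (B : Matrix n n ℝ) : ℝ :=
  e ⬝ᵥ B *ᵥ e - σ ^ 2 * B.trace

theorem centeredQuad_eq_dotProduct [DecidableEq n] (σ : ℝ) (e : n → ℝ) (B : Matrix n n ℝ) :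
    centeredQuad σ e B = (fun p : n × n => B p.1 p.2) ⬝ᵥ centeredProd σ e := by
  simp only [centeredQuad, dotProduct, centeredProd, Matrix.mulVec, Matrix.trace, Matrix.diag,
    Fintype.sum_prod_type, mul_sub, Finset.sum_sub_distrib, Finset.mul_sum]
  congr 1
  · exact Finset.sum_congr rfl fun i _ => Finset.sum_congr rfl fun j _ => by ring
  · exact Finset.sum_congr rfl fun i _ => by simp [mul_comm]

theorem centeredQuad_sum_smul {κ : Type*} [Fintype κ] (σ : ℝ) (e : n → ℝ) (c : κ → ℝ)
    (B : κ → Matrix n n ℝ) :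
    centeredQuad σ e (∑ a, c a • B a) = ∑ a, c a * centeredQuad σ e (B a) := by
  simp only [centeredQuad, Matrix.sum_mulVec, Matrix.smul_mulVec, dotProduct_sum, dotProduct_smul,
    smul_eq_mul, Matrix.trace_sum, Matrix.trace_smul, mul_sub, Finset.sum_sub_distrib,
    Finset.mul_sum]
  congr 1
  exact Finset.sum_congr rfl fun a _ => by ring

theorem centeredQuad_sum_smul_sq_le [DecidableEq n] {κ : Type*} [Fintype κ]
    (σ : ℝ) (e : n → ℝ) (c : κ → ℝ)
    (B : κ → Matrix n n ℝ) :
    centeredQuad σ e (∑ a, c a • B a) ^ 2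
      ≤ spanEnergy (vecColumns B) (centeredProd σ e) * frobSq (∑ a, c a • B a) := by
  have hv : vecColumns B *ᵥ c = fun p : n × n => (∑ a, c a • B a) p.1 p.2 := by
    funext p
    simp [vecColumns, Matrix.mulVec, dotProduct, Matrix.sum_apply, mul_comm]
  have h := dotProduct_mulVec_sq_le_spanEnergy (vecColumns B) (centeredProd σ e) c
  rw [hv] at h
  rw [centeredQuad_eq_dotProduct, dotProduct_comm]
  refine h.trans (le_of_eq ?_)
  congr 1
  simp only [frobSq, dotProduct, Fintype.sum_prod_type, sq]

theorem centeredQuad_zero (B : Matrix n n ℝ) : centeredQuad 0 0 B = 0 := by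
  simp [centeredQuad]

end QuadraticForm

/-! ### Averages of model projections and the deterministic comparison -/

section Averages

variable {N L M : ℕ}

/-- The matrix `∑_m u_m P_m` of one group of candidate models. -/
def groupMat (Q : Fin L → Fin M → Matrix (Fin N) (Fin N) ℝ) (u : Fin L → Fin M → ℝ) (l : Fin L) :
    Matrix (Fin N) (Fin N) ℝ :=
  ∑ m, u l m • Q l m

/-- The matrix `∑_ℓ w_ℓ ∑_m u_m^{(ℓ)} P_m^{(ℓ)}` of the two-round average. -/
def avgMat (Q : Fin L → Fin M → Matrix (Fin N) (Fin N) ℝ) (u : Fin L → Fin M → ℝ)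
    (w : Fin L → ℝ) : Matrix (Fin N) (Fin N) ℝ :=
  ∑ l, w l • groupMat Q u l

/-- The risk `‖μ - P(w) μ‖² + σ² ‖P(w)‖_F²` of the average with non-random weights and
non-random design. -/
def fixedRisk (σ : ℝ) (Q : Fin L → Fin M → Matrix (Fin N) (Fin N) ℝ) (u : Fin L → Fin M → ℝ)
    (μ : Fin N → ℝ) (w : Fin L → ℝ) : ℝ :=
  sqNorm (μ - avgMat Q u w *ᵥ μ) + σ ^ 2 * frobSq (avgMat Q u w)

/-- The matrix with columns `μ - P_ℓ μ`, the biases of the groups. -/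
def biasColumns (Q : Fin L → Fin M → Matrix (Fin N) (Fin N) ℝ) (u : Fin L → Fin M → ℝ)
    (μ : Fin N → ℝ) : Matrix (Fin N) (Fin L) ℝ :=
  Matrix.of fun i l => (μ - groupMat Q u l *ᵥ μ) i

/-- The matrix with columns `P_ℓ (μ - P_ℓ' μ)`. -/
def smoothedBiasColumns (Q : Fin L → Fin M → Matrix (Fin N) (Fin N) ℝ) (u : Fin L → Fin M → ℝ)
    (μ : Fin N → ℝ) : Matrix (Fin N) (Fin L × Fin L) ℝ :=
  Matrix.of fun i p => (groupMat Q u p.1 *ᵥ (μ - groupMat Q u p.2 *ᵥ μ)) i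

/-- The part of the remainder that does not involve estimated weights: energies of the errors, and
of their centred products, in spans of dimension at most `L` or `L²`. -/
noncomputable def noiseEnergy (σ : ℝ) (Q : Fin L → Fin M → Matrix (Fin N) (Fin N) ℝ)
    (u : Fin L → Fin M → ℝ) (μ e : Fin N → ℝ) : ℝ :=
  (spanEnergy (biasColumns Q u μ) e + spanEnergy (smoothedBiasColumns Q u μ) e) +
    (spanEnergy (vecColumns (groupMat Q u)) (centeredProd σ e) +
      spanEnergy (vecColumns fun p : Fin L × Fin L => groupMat Q u p.1 * groupMat Q u p.2)
        (centeredProd σ e)) / σ ^ 2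

/-- The part of the remainder that is linear in the deviation `d` of the first-round weights. -/
noncomputable def weightCross (σ : ℝ) (Q : Fin L → Fin M → Matrix (Fin N) (Fin N) ℝ)
    (d : Fin L → Fin M → ℝ) (μ e : Fin N → ℝ) : ℝ :=
  ∑ l, (√(sqNorm (d l)) * √(∑ m, (e ⬝ᵥ Q l m *ᵥ μ) ^ 2) +
    √(sqNorm (d l)) * √(∑ m, centeredQuad σ e (Q l m) ^ 2))

theorem groupMat_transpose {Q : Fin L → Fin M → Matrix (Fin N) (Fin N) ℝ}
    (hQ : ∀ l m, (Q l m)ᵀ = Q l m) (u : Fin L → Fin M → ℝ) (l : Fin L) :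
    (groupMat Q u l)ᵀ = groupMat Q u l := by
  simp only [groupMat, Matrix.transpose_sum, Matrix.transpose_smul, hQ]

theorem avgMat_transpose {Q : Fin L → Fin M → Matrix (Fin N) (Fin N) ℝ}
    (hQ : ∀ l m, (Q l m)ᵀ = Q l m) (u : Fin L → Fin M → ℝ) (w : Fin L → ℝ) :
    (avgMat Q u w)ᵀ = avgMat Q u w := by
  simp only [avgMat, Matrix.transpose_sum, Matrix.transpose_smul, groupMat_transpose hQ]

theorem isContraction_avgMat {Q : Fin L → Fin M → Matrix (Fin N) (Fin N) ℝ}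
    (hQ : ∀ l m, IsContraction (Q l m)) {u : Fin L → Fin M → ℝ}
    (hu : ∀ l, u l ∈ stdSimplex ℝ (Fin M)) {w : Fin L → ℝ} (hw : w ∈ stdSimplex ℝ (Fin L)) :
    IsContraction (avgMat Q u w) :=
  IsContraction.sum_smul hw fun l => IsContraction.sum_smul (hu l) (hQ l)

theorem avgMat_sub (Q : Fin L → Fin M → Matrix (Fin N) (Fin N) ℝ) (v u : Fin L → Fin M → ℝ)
    (w : Fin L → ℝ) : avgMat Q v w = avgMat Q u w + avgMat Q (v - u) w := by
  simp only [avgMat, groupMat, ← Finset.sum_add_distrib, ← smul_add, Pi.sub_apply, ← add_smul,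
    add_sub_cancel]

theorem biasColumns_mulVec (Q : Fin L → Fin M → Matrix (Fin N) (Fin N) ℝ) (u : Fin L → Fin M → ℝ)
    (μ : Fin N → ℝ) {w : Fin L → ℝ} (hw : w ∈ stdSimplex ℝ (Fin L)) :
    biasColumns Q u μ *ᵥ w = μ - avgMat Q u w *ᵥ μ := by
  have h1 : biasColumns Q u μ *ᵥ w = ∑ l, w l • (μ - groupMat Q u l *ᵥ μ) := by
    funext i
    simp [biasColumns, Matrix.mulVec, dotProduct, mul_comm]
  rw [h1, avgMat, Matrix.sum_mulVec]
  simp only [smul_sub, Finset.sum_sub_distrib, Matrix.smul_mulVec, ← Finset.sum_smul, hw.2,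
    one_smul]

theorem smoothedBiasColumns_mulVec (Q : Fin L → Fin M → Matrix (Fin N) (Fin N) ℝ)
    (u : Fin L → Fin M → ℝ) (μ : Fin N → ℝ) {w : Fin L → ℝ} (hw : w ∈ stdSimplex ℝ (Fin L)) :
    smoothedBiasColumns Q u μ *ᵥ (fun p => w p.1 * w p.2)
      = avgMat Q u w *ᵥ (μ - avgMat Q u w *ᵥ μ) := by
  have h1 : smoothedBiasColumns Q u μ *ᵥ (fun p => w p.1 * w p.2)
      = ∑ p : Fin L × Fin L, (w p.1 * w p.2) •
        (groupMat Q u p.1 *ᵥ (μ - groupMat Q u p.2 *ᵥ μ)) := by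
    funext i
    simp [smoothedBiasColumns, Matrix.mulVec, dotProduct, mul_comm]
  have h2 : μ - avgMat Q u w *ᵥ μ = ∑ l, w l • (μ - groupMat Q u l *ᵥ μ) := by
    rw [avgMat, Matrix.sum_mulVec]
    simp only [smul_sub, Finset.sum_sub_distrib, Matrix.smul_mulVec, ← Finset.sum_smul, hw.2,
      one_smul]
  rw [h1, h2, avgMat, Matrix.sum_mulVec, Fintype.sum_prod_type]
  simp only [Matrix.smul_mulVec, Matrix.mulVec_sum, Matrix.mulVec_smul, smul_smul]
  exact Finset.sum_congr rfl fun i _ => Finset.sum_congr rfl fun j _ => by rw [mul_comm]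

theorem avgMat_mul_avgMat (Q : Fin L → Fin M → Matrix (Fin N) (Fin N) ℝ)
    (u : Fin L → Fin M → ℝ) (w : Fin L → ℝ) :
    avgMat Q u w * avgMat Q u w
      = ∑ p : Fin L × Fin L, (w p.1 * w p.2) • (groupMat Q u p.1 * groupMat Q u p.2) := by
  simp only [avgMat, Fintype.sum_prod_type, Finset.sum_mul, Finset.mul_sum, Matrix.smul_mul,
    Matrix.mul_smul, smul_smul]
  rw [Finset.sum_comm]
  exact Finset.sum_congr rfl fun i _ => Finset.sum_congr rfl fun j _ => by rw [mul_comm (w j)]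

theorem abs_le_mul_of_sq_le {x U A R δ : ℝ} (h : x ^ 2 ≤ U * A) (hU : U ≤ δ ^ 2 * R) (hA : A ≤ R)
    (hU0 : 0 ≤ U) (hR : 0 ≤ R) (hδ : 0 ≤ δ) : |x| ≤ δ * R := by
  refine abs_le_of_sq_le_sq ?_ (by positivity)
  calc x ^ 2 ≤ U * A := h
    _ ≤ U * R := mul_le_mul_of_nonneg_left hA hU0
    _ ≤ δ ^ 2 * R * R := mul_le_mul_of_nonneg_right hU hR
    _ = (δ * R) ^ 2 := by ring

theorem abs_sum_mul_sum_mul_le {w : Fin L → ℝ} (hw : w ∈ stdSimplex ℝ (Fin L))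
    (d x : Fin L → Fin M → ℝ) :
    |∑ l, w l * ∑ m, d l m * x l m| ≤ ∑ l, √(sqNorm (d l)) * √(∑ m, x l m ^ 2) := by
  refine (Finset.abs_sum_le_sum_abs _ _).trans (Finset.sum_le_sum fun l _ => ?_)
  have h1 : w l ≤ 1 := by
    rw [← hw.2]
    exact Finset.single_le_sum (fun i _ => hw.1 i) (Finset.mem_univ l)
  have h2 : |∑ m, d l m * x l m| ≤ √(sqNorm (d l)) * √(∑ m, x l m ^ 2) := by
    rw [← Real.sqrt_mul (show 0 ≤ sqNorm (d l) from dotProduct_self_nonneg_real _)]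
    refine Real.abs_le_sqrt ?_
    have := Finset.sum_mul_sq_le_sq_mul_sq Finset.univ (d l) (x l)
    simpa only [sqNorm, dotProduct, ← sq] using this
  rw [abs_mul, abs_of_nonneg (hw.1 l)]
  calc w l * |∑ m, d l m * x l m| ≤ 1 * |∑ m, d l m * x l m| :=
        mul_le_mul_of_nonneg_right h1 (abs_nonneg _)
    _ ≤ _ := by rw [one_mul]; exact h2

theorem fixedRisk_nonneg (σ : ℝ) (Q : Fin L → Fin M → Matrix (Fin N) (Fin N) ℝ)
    (u : Fin L → Fin M → ℝ) (μ : Fin N → ℝ) (w : Fin L → ℝ) : 0 ≤ fixedRisk σ Q u μ w :=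
  add_nonneg (dotProduct_self_nonneg_real _) (mul_nonneg (sq_nonneg _) (frobSq_nonneg _))

/-- The squared norm of the effect of the weight deviations on the fit. -/
theorem sqNorm_avgMat_mulVec_le {Q : Fin L → Fin M → Matrix (Fin N) (Fin N) ℝ}
    (hQ : ∀ l m, IsContraction (Q l m)) (d : Fin L → Fin M → ℝ) {w : Fin L → ℝ}
    (hw : w ∈ stdSimplex ℝ (Fin L)) (y : Fin N → ℝ) :
    sqNorm (avgMat Q d w *ᵥ y) ≤ M * (∑ l, sqNorm (d l)) * sqNorm y := by
  have h1 : ∀ l, w l ≤ 1 := by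
    intro l
    rw [← hw.2]
    exact Finset.single_le_sum (fun i _ => hw.1 i) (Finset.mem_univ l)
  have h := dotProduct_self_sum_smul_le (fun p : Fin L × Fin M => w p.1 * d p.1 p.2)
    (fun p => w p.1 * d p.1 p.2 ^ 2) (fun p => w p.1) (fun p => Q p.1 p.2 *ᵥ y)
    (fun p => mul_nonneg (hw.1 _) (sq_nonneg _)) (fun p => hw.1 _) (fun p => by ring_nf; rfl)
  have h2 : avgMat Q d w *ᵥ y
      = ∑ p : Fin L × Fin M, (w p.1 * d p.1 p.2) • (Q p.1 p.2 *ᵥ y) := by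
    simp only [avgMat, groupMat, Fintype.sum_prod_type, Matrix.sum_mulVec, Matrix.smul_mulVec,
      Finset.smul_sum, smul_smul]
  have h3 : ∑ p : Fin L × Fin M, w p.1 * d p.1 p.2 ^ 2 ≤ ∑ l, sqNorm (d l) := by
    rw [Fintype.sum_prod_type]
    refine Finset.sum_le_sum fun l _ => ?_
    rw [sqNorm, dotProduct]
    refine Finset.sum_le_sum fun m _ => ?_
    have := mul_le_mul_of_nonneg_right (h1 l) (sq_nonneg (d l m))
    linarith [sq (d l m)]
  have h4 : ∑ p : Fin L × Fin M, w p.1 * ((Q p.1 p.2 *ᵥ y) ⬝ᵥ (Q p.1 p.2 *ᵥ y))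
      ≤ M * sqNorm y := by
    rw [Fintype.sum_prod_type]
    calc ∑ l, ∑ m, w l * ((Q l m *ᵥ y) ⬝ᵥ (Q l m *ᵥ y))
        ≤ ∑ l, ∑ _m : Fin M, w l * sqNorm y :=
          Finset.sum_le_sum fun l _ => Finset.sum_le_sum fun m _ =>
            mul_le_mul_of_nonneg_left (hQ l m y) (hw.1 l)
      _ = M * sqNorm y := by
          simp only [Finset.sum_const, Finset.card_univ, Fintype.card_fin, nsmul_eq_mul]
          rw [← Finset.mul_sum, ← Finset.sum_mul, hw.2, one_mul]
  rw [h2, sqNorm]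
  refine h.trans ?_
  calc _ ≤ (∑ l, sqNorm (d l)) * (M * sqNorm y) := by
        refine mul_le_mul h3 h4 ?_ ?_
        · exact Finset.sum_nonneg fun p _ =>
            mul_nonneg (hw.1 _) (dotProduct_self_nonneg_real _)
        · exact Finset.sum_nonneg fun l _ => dotProduct_self_nonneg_real _
    _ = _ := by ring

end Averages

section Comparison

variable {N L M : ℕ} {σ δ : ℝ} {Q : Fin L → Fin M → Matrix (Fin N) (Fin N) ℝ}
  {u v : Fin L → Fin M → ℝ} {μ e : Fin N → ℝ} {w : Fin L → ℝ}

/-- The bounds that `noiseEnergy` gives for the linear and quadratic forms in the errors. -/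
theorem noise_bounds (hQc : ∀ l m, IsContraction (Q l m))
    (hu : ∀ l, u l ∈ stdSimplex ℝ (Fin M)) (hw : w ∈ stdSimplex ℝ (Fin L)) (hδ : 0 ≤ δ)
    (hσ : σ = 0 → e = 0) (hE : noiseEnergy σ Q u μ e ≤ δ ^ 2 * fixedRisk σ Q u μ w) :
    |e ⬝ᵥ (μ - avgMat Q u w *ᵥ μ)| ≤ δ * fixedRisk σ Q u μ w ∧
    |e ⬝ᵥ avgMat Q u w *ᵥ (μ - avgMat Q u w *ᵥ μ)| ≤ δ * fixedRisk σ Q u μ w ∧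
    |centeredQuad σ e (avgMat Q u w)| ≤ δ * fixedRisk σ Q u μ w ∧
    |centeredQuad σ e (avgMat Q u w * avgMat Q u w)| ≤ δ * fixedRisk σ Q u μ w := by
  set R := fixedRisk σ Q u μ w with hRdef
  have hR : 0 ≤ R := fixedRisk_nonneg ..
  have hc := isContraction_avgMat hQc hu hw
  have hb : sqNorm (μ - avgMat Q u w *ᵥ μ) ≤ R :=
    le_add_of_nonneg_right (mul_nonneg (sq_nonneg _) (frobSq_nonneg _))
  have hf : σ ^ 2 * frobSq (avgMat Q u w) ≤ R :=
    le_add_of_nonneg_left (dotProduct_self_nonneg_real _)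
  have n1 := spanEnergy_nonneg (biasColumns Q u μ) e
  have n2 := spanEnergy_nonneg (smoothedBiasColumns Q u μ) e
  have n3 := spanEnergy_nonneg (vecColumns (groupMat Q u)) (centeredProd σ e)
  have n4 := spanEnergy_nonneg
    (vecColumns fun p : Fin L × Fin L => groupMat Q u p.1 * groupMat Q u p.2) (centeredProd σ e)
  have q1 := dotProduct_mulVec_sq_le_spanEnergy (biasColumns Q u μ) e w
  have q2 := dotProduct_mulVec_sq_le_spanEnergy (smoothedBiasColumns Q u μ) e
    (fun p => w p.1 * w p.2)
  have q3 := centeredQuad_sum_smul_sq_le σ e w (groupMat Q u)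
  have q4 := centeredQuad_sum_smul_sq_le σ e (fun p : Fin L × Fin L => w p.1 * w p.2)
    (fun p => groupMat Q u p.1 * groupMat Q u p.2)
  rw [biasColumns_mulVec Q u μ hw] at q1
  rw [smoothedBiasColumns_mulVec Q u μ hw] at q2
  rw [← avgMat_mul_avgMat] at q4
  rw [noiseEnergy] at hE
  set U₁ := spanEnergy (biasColumns Q u μ) e
  set U₂ := spanEnergy (smoothedBiasColumns Q u μ) e
  set U₃ := spanEnergy (vecColumns (groupMat Q u)) (centeredProd σ e)
  set U₄ := spanEnergy
    (vecColumns fun p : Fin L × Fin L => groupMat Q u p.1 * groupMat Q u p.2) (centeredProd σ e)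
  have n34 : 0 ≤ (U₃ + U₄) / σ ^ 2 := by positivity
  -- for `σ ≠ 0` the factor `σ²` moves from the Frobenius norm to the energy
  have quad : ∀ x U A : ℝ, x ^ 2 ≤ U * A → 0 ≤ U → U ≤ U₃ + U₄ → A ≤ frobSq (avgMat Q u w) →
      (e = 0 → σ = 0 → x = 0) → |x| ≤ δ * R := by
    intro x U A hx hU0 hU hA h0
    rcases eq_or_ne σ 0 with hs | hs
    · rw [h0 (hσ hs) hs, abs_zero]
      positivity
    · have hs2 : 0 < σ ^ 2 := by positivity
      refine abs_le_mul_of_sq_le (U := U / σ ^ 2) (A := σ ^ 2 * A) ?_ ?_ ?_ (by positivity) hR hδ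
      · calc x ^ 2 ≤ U * A := hx
          _ = _ := by field_simp
      · have : U / σ ^ 2 ≤ (U₃ + U₄) / σ ^ 2 := by gcongr
        linarith
      · exact (mul_le_mul_of_nonneg_left hA hs2.le).trans hf
  refine ⟨?_, ?_, ?_, ?_⟩
  · exact abs_le_mul_of_sq_le q1 (by linarith) hb n1 hR hδ
  · exact abs_le_mul_of_sq_le q2 (by linarith) ((hc _).trans hb) n2 hR hδ
  · refine quad _ _ _ q3 n3 (by linarith) le_rfl ?_
    rintro rfl rfl
    exact centeredQuad_zero _
  · refine quad _ _ _ q4 n4 (by linarith) (hc.frobSq_mul_le _) ?_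
    rintro rfl rfl
    exact centeredQuad_zero _

theorem sqNorm_sub (x y : Fin N → ℝ) :
    sqNorm (x - y) = sqNorm x - 2 * (x ⬝ᵥ y) + sqNorm y := by
  simp only [sqNorm, sub_dotProduct, dotProduct_sub, dotProduct_comm y x]
  ring

theorem mulVec_add_sub_eq (A : Matrix (Fin N) (Fin N) ℝ) (μ e : Fin N → ℝ) :
    A *ᵥ (μ + e) - μ = A *ᵥ e - (μ - A *ᵥ μ) := by
  rw [Matrix.mulVec_add]
  abel

theorem sqNorm_mulVec_sub {A : Matrix (Fin N) (Fin N) ℝ} (hA : Aᵀ = A) (b e : Fin N → ℝ) (σ : ℝ) :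
    sqNorm (A *ᵥ e - b) = sqNorm b + σ ^ 2 * frobSq A + centeredQuad σ e (A * A)
      - 2 * (e ⬝ᵥ A *ᵥ b) := by
  have h1 : e ⬝ᵥ (A * A) *ᵥ e = (A *ᵥ e) ⬝ᵥ (A *ᵥ e) := by
    rw [← Matrix.mulVec_mulVec, dotProduct_mulVec_of_symm hA]
  have h2 : (A * A).trace = frobSq A := by
    conv_lhs => rw [← hA]
    simp only [frobSq, Matrix.trace, Matrix.diag, Matrix.mul_apply, Matrix.transpose_apply]
    rw [Finset.sum_comm]
    refine Finset.sum_congr rfl fun i _ => Finset.sum_congr rfl fun j _ => ?_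
    have : A j i = A i j := by conv_lhs => rw [← hA, Matrix.transpose_apply]
    rw [sq, this]
  have h3 := dotProduct_mulVec_of_symm hA e b
  rw [centeredQuad, h1, h2, h3, sqNorm_sub, sqNorm, sqNorm]
  ring

/-- The loss of the two-round average is uniformly close to the risk with non-random weights. -/
theorem abs_loss_sub_fixedRisk_le (hQs : ∀ l m, (Q l m)ᵀ = Q l m)
    (hQc : ∀ l m, IsContraction (Q l m)) (hu : ∀ l, u l ∈ stdSimplex ℝ (Fin M))
    (hw : w ∈ stdSimplex ℝ (Fin L)) (hδ : 0 ≤ δ) (hδ1 : δ ≤ 1) (hσ : σ = 0 → e = 0)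
    (hE : noiseEnergy σ Q u μ e ≤ δ ^ 2 * fixedRisk σ Q u μ w)
    (hD : M * (∑ l, sqNorm ((v - u) l)) * sqNorm (μ + e) ≤ δ ^ 2 * fixedRisk σ Q u μ w) :
    |sqNorm (avgMat Q v w *ᵥ (μ + e) - μ) - fixedRisk σ Q u μ w|
      ≤ 8 * δ * fixedRisk σ Q u μ w := by
  obtain ⟨-, h2, -, h4⟩ := noise_bounds hQc hu hw hδ hσ hE
  have hR : 0 ≤ fixedRisk σ Q u μ w := fixedRisk_nonneg ..
  have hΔ := (sqNorm_avgMat_mulVec_le hQc (v - u) hw (μ + e)).trans hD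
  have ha := sqNorm_mulVec_sub (avgMat_transpose hQs u w) (μ - avgMat Q u w *ᵥ μ) e σ
  rw [← mulVec_add_sub_eq] at ha
  have hdec : avgMat Q v w *ᵥ (μ + e) - μ
      = (avgMat Q u w *ᵥ (μ + e) - μ) + avgMat Q (v - u) w *ᵥ (μ + e) := by
    rw [avgMat_sub Q v u w, Matrix.add_mulVec]
    abel
  have hRe : fixedRisk σ Q u μ w
      = sqNorm (μ - avgMat Q u w *ᵥ μ) + σ ^ 2 * frobSq (avgMat Q u w) := rfl
  rw [← hRe] at ha
  rw [hdec]
  set R := fixedRisk σ Q u μ w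
  set a := avgMat Q u w *ᵥ (μ + e) - μ
  set Δ := avgMat Q (v - u) w *ᵥ (μ + e)
  have hexp : sqNorm (a + Δ) = sqNorm a + 2 * (a ⬝ᵥ Δ) + sqNorm Δ := by
    simp only [sqNorm, add_dotProduct, dotProduct_add, dotProduct_comm Δ a]
    ring
  have hΔ0 : 0 ≤ sqNorm Δ := dotProduct_self_nonneg_real _
  have hδR : δ * R ≤ R := by nlinarith
  have hδR0 : 0 ≤ δ * R := by positivity
  rw [abs_le] at h2 h4
  have haR : sqNorm a ≤ 4 * R := by linarith [h2.1, h4.2]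
  have hcr : |a ⬝ᵥ Δ| ≤ 2 * δ * R := by
    refine abs_le_of_sq_le_sq ?_ (by positivity)
    calc (a ⬝ᵥ Δ) ^ 2 ≤ sqNorm a * sqNorm Δ := dotProduct_sq_le _ _
      _ ≤ 4 * R * (δ ^ 2 * R) := by gcongr
      _ = (2 * δ * R) ^ 2 := by ring
  have hΔ' : sqNorm Δ ≤ δ * R := hΔ.trans (by nlinarith)
  rw [abs_le] at hcr ⊢
  constructor <;> linarith [h2.1, h2.2, h4.1, h4.2, hcr.1, hcr.2]

/-- Up to the constant `‖e‖²`, the Mallows criterion is uniformly close to the loss. -/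
theorem abs_mallows_sub_loss_le
    (hQc : ∀ l m, IsContraction (Q l m)) (hu : ∀ l, u l ∈ stdSimplex ℝ (Fin M))
    (hw : w ∈ stdSimplex ℝ (Fin L)) (hδ : 0 ≤ δ) (hσ : σ = 0 → e = 0)
    (hE : noiseEnergy σ Q u μ e ≤ δ ^ 2 * fixedRisk σ Q u μ w)
    (hT : weightCross σ Q (v - u) μ e ≤ δ * fixedRisk σ Q u μ w) :
    |sqNorm (μ + e - avgMat Q v w *ᵥ (μ + e)) + 2 * σ ^ 2 * (avgMat Q v w).trace - sqNorm e
      - sqNorm (avgMat Q v w *ᵥ (μ + e) - μ)| ≤ 8 * δ * fixedRisk σ Q u μ w := by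
  obtain ⟨h1, -, h3, -⟩ := noise_bounds hQc hu hw hδ hσ hE
  have hR : 0 ≤ fixedRisk σ Q u μ w := fixedRisk_nonneg ..
  set A := avgMat Q u w with hA
  set D := avgMat Q (v - u) w with hD
  have hdec : avgMat Q v w = A + D := avgMat_sub Q v u w
  have hDμ : e ⬝ᵥ D *ᵥ μ = ∑ l, w l * ∑ m, (v - u) l m * (e ⬝ᵥ Q l m *ᵥ μ) := by
    simp only [hD, avgMat, groupMat, Matrix.sum_mulVec, Matrix.smul_mulVec, dotProduct_sum,
      dotProduct_smul, smul_eq_mul]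
  have hDQ : centeredQuad σ e D
      = ∑ l, w l * ∑ m, (v - u) l m * centeredQuad σ e (Q l m) := by
    simp only [hD, avgMat, groupMat, centeredQuad_sum_smul]
  have b1 := abs_sum_mul_sum_mul_le hw (v - u) fun l m => e ⬝ᵥ Q l m *ᵥ μ
  have b2 := abs_sum_mul_sum_mul_le hw (v - u) fun l m => centeredQuad σ e (Q l m)
  rw [← hDμ] at b1
  rw [← hDQ] at b2
  rw [weightCross, Finset.sum_add_distrib] at hT
  have hexp : sqNorm (μ + e - avgMat Q v w *ᵥ (μ + e)) + 2 * σ ^ 2 * (avgMat Q v w).trace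
      - sqNorm e - sqNorm (avgMat Q v w *ᵥ (μ + e) - μ)
      = 2 * (e ⬝ᵥ (μ - A *ᵥ μ) - e ⬝ᵥ D *ᵥ μ - centeredQuad σ e A - centeredQuad σ e D) := by
    have e1 : μ + e - avgMat Q v w *ᵥ (μ + e) = e - (avgMat Q v w *ᵥ (μ + e) - μ) := by abel
    have e2 : e ⬝ᵥ (avgMat Q v w *ᵥ (μ + e) - μ)
        = -(e ⬝ᵥ (μ - A *ᵥ μ)) + e ⬝ᵥ D *ᵥ μ + e ⬝ᵥ A *ᵥ e + e ⬝ᵥ D *ᵥ e := by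
      rw [hdec]
      simp only [Matrix.add_mulVec, Matrix.mulVec_add, dotProduct_sub, dotProduct_add]
      ring
    rw [e1]
    rw [sqNorm_sub, e2, hdec, Matrix.trace_add, centeredQuad, centeredQuad]
    ring
  rw [hexp]
  have hδR0 : 0 ≤ δ * fixedRisk σ Q u μ w := by positivity
  have s1 := abs_nonneg (e ⬝ᵥ D *ᵥ μ)
  rw [abs_le] at h1 h3 b1 b2 ⊢
  constructor <;> linarith [h1.1, h1.2, h3.1, h3.2, b1.1, b1.2, b2.1, b2.2]

end Comparison

/-- A minimizer of a criterion that agrees with `loss`, up to a constant and a small multiple of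
`risk`, nearly minimizes `loss`, if `loss` and `risk` also agree up to a small multiple of
`risk`. -/
theorem abs_div_iInf_sub_one_le {α : Type*} {s : Set α} [Nonempty s] {loss risk crit : α → ℝ}
    {c ξ η : ℝ} {a : α} (ha : a ∈ s) (hξ : 0 < ξ) (hη0 : 0 ≤ η) (hη : η ≤ 1 / 4)
    (hrisk : ∀ x ∈ s, ξ ≤ risk x) (hloss : ∀ x ∈ s, |loss x - risk x| ≤ η * risk x)
    (hcrit : ∀ x ∈ s, |crit x - c - loss x| ≤ η * risk x) (hmin : IsMinOn crit s a) :
    |loss a / (⨅ x : s, loss x) - 1| ≤ 4 * η := by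
  have hpos : ∀ x ∈ s, (1 - η) * ξ ≤ loss x := by
    intro x hx
    have h1 := (abs_le.1 (hloss x hx)).1
    nlinarith [hrisk x hx]
  have hbdd : BddBelow (Set.range fun x : s => loss x) :=
    ⟨(1 - η) * ξ, by rintro _ ⟨x, rfl⟩; exact hpos x x.2⟩
  have hinf_pos : 0 < ⨅ x : s, loss x :=
    lt_of_lt_of_le (by nlinarith) (le_ciInf fun x : s => hpos x x.2)
  have hinf_le : (⨅ x : s, loss x) ≤ loss a := ciInf_le hbdd (⟨a, ha⟩ : s)
  have hle : loss a * (1 - 2 * η) ≤ ⨅ x : s, loss x := by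
    refine le_ciInf fun x => ?_
    have a1 := abs_le.1 (hloss a ha)
    have a2 := abs_le.1 (hcrit a ha)
    have x1 := abs_le.1 (hloss x x.2)
    have x2 := abs_le.1 (hcrit x x.2)
    have hm : crit a ≤ crit x := hmin x.2
    have ra := hrisk a ha
    have rx := hrisk x x.2
    have k1 : (1 - η) * (loss a) ≤ (1 - η) * loss x + η * ((1 - η) * risk a)
        + η * ((1 - η) * risk x) := by nlinarith
    have k2 : (1 - η) * risk a ≤ loss a := by linarith [a1.1]
    have k3 : (1 - η) * risk x ≤ loss x := by linarith [x1.1]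
    nlinarith
  have h1 : 1 ≤ loss a / ⨅ x : s, loss x := (one_le_div hinf_pos).2 hinf_le
  have h2 : loss a / (⨅ x : s, loss x) ≤ 1 + 4 * η := by
    rw [div_le_iff₀ hinf_pos]
    nlinarith
  rw [abs_le]
  constructor <;> linarith

/-! ### Moment bounds -/

section MeanLe

variable {Ω : Type*} [MeasurableSpace Ω] {ν : Measure Ω}

/-- `f` is a nonnegative random variable with mean at most `a`; the mean is a Lebesgue integral, so
that integrability is part of the assertion. -/
structure MeanLe (ν : Measure Ω) (f : Ω → ℝ) (a : ℝ) : Prop where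
  aemeasurable : AEMeasurable f ν
  nonneg : ∀ ω, 0 ≤ f ω
  bound_nonneg : 0 ≤ a
  lintegral_le : ∫⁻ ω, ENNReal.ofReal (f ω) ∂ν ≤ ENNReal.ofReal a

theorem MeanLe.mono {f g : Ω → ℝ} {a b : ℝ} (hg : MeanLe ν g b) (hf : AEMeasurable f ν)
    (hf0 : ∀ ω, 0 ≤ f ω) (hfg : ∀ ω, f ω ≤ g ω) (hba : b ≤ a) : MeanLe ν f a where
  aemeasurable := hf
  nonneg := hf0
  bound_nonneg := hg.bound_nonneg.trans hba
  lintegral_le := (lintegral_mono fun ω => ENNReal.ofReal_le_ofReal (hfg ω)).trans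
    (hg.lintegral_le.trans (ENNReal.ofReal_le_ofReal hba))

theorem MeanLe.mono_right {f : Ω → ℝ} {a b : ℝ} (hf : MeanLe ν f b) (hba : b ≤ a) :
    MeanLe ν f a :=
  hf.mono hf.aemeasurable hf.nonneg (fun _ => le_rfl) hba

theorem MeanLe.add {f g : Ω → ℝ} {a b : ℝ} (hf : MeanLe ν f a) (hg : MeanLe ν g b) :
    MeanLe ν (fun ω => f ω + g ω) (a + b) where
  aemeasurable := hf.aemeasurable.add hg.aemeasurable
  nonneg ω := add_nonneg (hf.nonneg ω) (hg.nonneg ω)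
  bound_nonneg := add_nonneg hf.bound_nonneg hg.bound_nonneg
  lintegral_le := by
    simp only [ENNReal.ofReal_add (hf.nonneg _) (hg.nonneg _)]
    rw [lintegral_add_left' hf.aemeasurable.ennreal_ofReal,
      ENNReal.ofReal_add hf.bound_nonneg hg.bound_nonneg]
    exact add_le_add hf.lintegral_le hg.lintegral_le

theorem MeanLe.const_mul {f : Ω → ℝ} {a c : ℝ} (hf : MeanLe ν f a) (hc : 0 ≤ c) :
    MeanLe ν (fun ω => c * f ω) (c * a) where
  aemeasurable := hf.aemeasurable.const_mul c
  nonneg ω := mul_nonneg hc (hf.nonneg ω)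
  bound_nonneg := mul_nonneg hc hf.bound_nonneg
  lintegral_le := by
    simp only [ENNReal.ofReal_mul hc]
    rw [lintegral_const_mul'' _ hf.aemeasurable.ennreal_ofReal]
    exact mul_le_mul_right hf.lintegral_le _

theorem MeanLe.sum {ι : Type*} (s : Finset ι) {f : ι → Ω → ℝ} {a : ι → ℝ}
    (h : ∀ i ∈ s, MeanLe ν (f i) (a i)) : MeanLe ν (fun ω => ∑ i ∈ s, f i ω) (∑ i ∈ s, a i) := by
  classical
  induction s using Finset.induction_on with
  | empty => exact ⟨by simp, by simp, by simp, by simp⟩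
  | insert i s hi ih =>
    simp only [Finset.sum_insert hi]
    exact (h i (Finset.mem_insert_self i s)).add
      (ih fun j hj => h j (Finset.mem_insert_of_mem hj))

theorem MeanLe.const [IsProbabilityMeasure ν] {a : ℝ} (ha : 0 ≤ a) : MeanLe ν (fun _ => a) a :=
  ⟨aemeasurable_const, fun _ => ha, ha, by simp⟩

/-- The Cauchy-Schwarz inequality. -/
theorem MeanLe.sqrt_mul_sqrt {f g : Ω → ℝ} {a b : ℝ} (hf : MeanLe ν f a) (hg : MeanLe ν g b) :
    MeanLe ν (fun ω => √(f ω) * √(g ω)) (√a * √b) where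
  aemeasurable := hf.aemeasurable.sqrt.mul hg.aemeasurable.sqrt
  nonneg ω := by positivity
  bound_nonneg := by positivity
  lintegral_le := by
    have hsq : ∀ x : ℝ, 0 ≤ x → ENNReal.ofReal (√x) ^ (2 : ℝ) = ENNReal.ofReal x := by
      intro x hx
      rw [ENNReal.rpow_two, ← ENNReal.ofReal_pow (Real.sqrt_nonneg x), Real.sq_sqrt hx]
    have hrt : ∀ x : ℝ, 0 ≤ x → ENNReal.ofReal x ^ (1 / (2 : ℝ)) = ENNReal.ofReal (√x) := by
      intro x hx
      rw [ENNReal.ofReal_rpow_of_nonneg hx (by norm_num), Real.sqrt_eq_rpow]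
    have h := ENNReal.lintegral_mul_le_Lp_mul_Lq ν Real.HolderConjugate.two_two
      hf.aemeasurable.sqrt.ennreal_ofReal hg.aemeasurable.sqrt.ennreal_ofReal
    simp only [hsq _ (hf.nonneg _), hsq _ (hg.nonneg _)] at h
    simp only [ENNReal.ofReal_mul (Real.sqrt_nonneg _)]
    refine (le_trans h ?_)
    rw [← hrt a hf.bound_nonneg, ← hrt b hg.bound_nonneg]
    exact mul_le_mul' (ENNReal.rpow_le_rpow hf.lintegral_le (by norm_num))
      (ENNReal.rpow_le_rpow hg.lintegral_le (by norm_num))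

theorem MeanLe.of_integral {f : Ω → ℝ} {a : ℝ} (hf : Integrable f ν) (hf0 : ∀ ω, 0 ≤ f ω)
    (h : ∫ ω, f ω ∂ν ≤ a) : MeanLe ν f a where
  aemeasurable := hf.aemeasurable
  nonneg := hf0
  bound_nonneg := (integral_nonneg hf0).trans h
  lintegral_le := by
    rw [← ofReal_integral_eq_lintegral_ofReal hf (Eventually.of_forall hf0)]
    exact ENNReal.ofReal_le_ofReal h

end MeanLe

section SecondMoments

variable {Ω : Type*} [MeasurableSpace Ω] {ν : Measure Ω} {ι κ : Type*} [Fintype ι] [Fintype κ]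

/-- `z` is square integrable, and the second moment of `⟨c, z⟩` is at most `v ‖c‖²`, for every
vector `c`. -/
structure SecondMomentLe (ν : Measure Ω) (z : Ω → ι → ℝ) (v : ℝ) : Prop where
  memLp : ∀ i, MemLp (fun ω => z ω i) 2 ν
  integral_le : ∀ c : ι → ℝ, ∫ ω, (c ⬝ᵥ z ω) ^ 2 ∂ν ≤ v * (c ⬝ᵥ c)

theorem memLp_dotProduct {z : Ω → ι → ℝ} (hz : ∀ i, MemLp (fun ω => z ω i) 2 ν) (c : ι → ℝ) :
    MemLp (fun ω => c ⬝ᵥ z ω) 2 ν :=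
  memLp_finsetSum _ fun i _ => (hz i).const_mul (c i)

theorem integral_dotProduct_sq {z : Ω → ι → ℝ} (hz : ∀ i, MemLp (fun ω => z ω i) 2 ν)
    (c : ι → ℝ) :
    ∫ ω, (c ⬝ᵥ z ω) ^ 2 ∂ν = ∑ i, ∑ j, c i * c j * ∫ ω, z ω i * z ω j ∂ν := by
  have hint : ∀ i j, Integrable (fun ω => z ω i * z ω j) ν := fun i j =>
    (hz i).integrable_mul (hz j)
  have h1 : ∀ ω, (c ⬝ᵥ z ω) ^ 2 = ∑ i, ∑ j, c i * c j * (z ω i * z ω j) := by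
    intro ω
    rw [sq, dotProduct, Finset.sum_mul_sum]
    exact Finset.sum_congr rfl fun i _ => Finset.sum_congr rfl fun j _ => by ring
  simp only [h1]
  rw [integral_finsetSum _ fun i _ => integrable_finsetSum _ fun j _ => (hint i j).const_mul _]
  refine Finset.sum_congr rfl fun i _ => ?_
  rw [integral_finsetSum _ fun j _ => (hint i j).const_mul _]
  exact Finset.sum_congr rfl fun j _ => integral_const_mul _ _

theorem SecondMomentLe.meanLe_sq {z : Ω → ι → ℝ} {v : ℝ} (hz : SecondMomentLe ν z v)
    (c : ι → ℝ) : MeanLe ν (fun ω => (c ⬝ᵥ z ω) ^ 2) (v * (c ⬝ᵥ c)) :=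
  MeanLe.of_integral (memLp_dotProduct hz.memLp c).integrable_sq (fun _ => sq_nonneg _)
    (hz.integral_le c)

/-- The energy in a span is of the order of the dimension of the span. -/
theorem SecondMomentLe.meanLe_spanEnergy {z : Ω → ι → ℝ} {v : ℝ} (hv : 0 ≤ v)
    (hz : SecondMomentLe ν z v) (F : Matrix ι κ ℝ) :
    MeanLe ν (fun ω => spanEnergy F (z ω)) (v * Fintype.card κ) := by
  have h : MeanLe ν (fun ω => ∑ i, (projMat F i ⬝ᵥ z ω) ^ 2)
      (∑ i, v * (projMat F i ⬝ᵥ projMat F i)) :=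
    MeanLe.sum _ fun i _ => hz.meanLe_sq (projMat F i)
  have h1 : ∑ i, v * (projMat F i ⬝ᵥ projMat F i) = v * (projMat F).trace := by
    rw [← frobSq_of_symm_idem (projMat_transpose F) (projMat_mul_projMat F), ← Finset.mul_sum]
    simp only [frobSq, dotProduct, sq]
  have h2 : (fun ω => spanEnergy F (z ω)) = fun ω => ∑ i, (projMat F i ⬝ᵥ z ω) ^ 2 := by
    funext ω
    simp only [spanEnergy, sq]
    rfl
  rw [h2]
  refine h.mono_right ?_
  rw [h1]
  exact mul_le_mul_of_nonneg_left (trace_projMat_le F) hv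

end SecondMoments

section WhiteNoise

variable {Ω : Type*} [MeasurableSpace Ω] {ν : Measure Ω} {n : ℕ} {e : Ω → Fin n → ℝ} {σ κ : ℝ}

/-- The errors behave, up to fourth moments, like independent centred errors with variance `σ²`.
The fourth moments enter through `κ`, in a form that forces the errors to vanish for `σ = 0`. -/
structure WhiteNoise (ν : Measure Ω) (e : Ω → Fin n → ℝ) (σ κ : ℝ) : Prop where
  memLp : ∀ i, MemLp (fun ω => e ω i) 2 ν
  memLp_centered : ∀ p, MemLp (fun ω => centeredProd σ (e ω) p) 2 ν
  mean : ∀ i, ∫ ω, e ω i ∂ν = 0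
  mean_centered : ∀ p, ∫ ω, centeredProd σ (e ω) p ∂ν = 0
  cross : ∀ p q : Fin n × Fin n, q ≠ p → q ≠ p.swap →
    ∫ ω, centeredProd σ (e ω) p * centeredProd σ (e ω) q ∂ν = 0
  fourth : ∀ p, ∫ ω, centeredProd σ (e ω) p ^ 2 ∂ν ≤ κ * σ ^ 2

theorem centeredProd_swap (σ : ℝ) (e : Fin n → ℝ) (p : Fin n × Fin n) :
    centeredProd σ e p.swap = centeredProd σ e p := by
  simp only [centeredProd, Prod.fst_swap, Prod.snd_swap, eq_comm, mul_comm]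

theorem WhiteNoise.secondMomentLe [IsProbabilityMeasure ν] (h : WhiteNoise ν e σ κ) :
    SecondMomentLe ν e (σ ^ 2) := by
  refine ⟨h.memLp, fun c => le_of_eq ?_⟩
  have hij : ∀ i j, ∫ ω, e ω i * e ω j ∂ν = if i = j then σ ^ 2 else 0 := by
    intro i j
    have h1 := h.mean_centered (i, j)
    simp only [centeredProd] at h1
    have hint : Integrable (fun ω => e ω i * e ω j) ν := (h.memLp i).integrable_mul (h.memLp j)
    rw [integral_sub hint (integrable_const _)] at h1
    simpa [sub_eq_zero] using h1
  rw [integral_dotProduct_sq h.memLp]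
  simp only [hij, dotProduct, Finset.mul_sum, mul_ite, mul_zero, Finset.sum_ite_eq,
    Finset.mem_univ, if_true]
  exact Finset.sum_congr rfl fun i _ => by ring

theorem WhiteNoise.secondMomentLe_centered (h : WhiteNoise ν e σ κ) :
    SecondMomentLe ν (fun ω => centeredProd σ (e ω)) (2 * κ * σ ^ 2) := by
  refine ⟨h.memLp_centered, fun c => ?_⟩
  rw [integral_dotProduct_sq h.memLp_centered]
  set s : Fin n × Fin n → ℝ := fun p => ∫ ω, centeredProd σ (e ω) p ^ 2 ∂ν with hs
  have hs0 : ∀ p, 0 ≤ s p := fun p => integral_nonneg fun ω => sq_nonneg _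
  have hrow : ∀ p, ∑ q, c p * c q * ∫ ω, centeredProd σ (e ω) p * centeredProd σ (e ω) q ∂ν
      ≤ κ * σ ^ 2 * (3 / 2 * c p ^ 2 + 1 / 2 * c p.swap ^ 2) := by
    intro p
    have hq : ∀ q, c p * c q * ∫ ω, centeredProd σ (e ω) p * centeredProd σ (e ω) q ∂ν
        ≤ (if q = p then s p * c p ^ 2 else 0)
          + if q = p.swap then s p * (1 / 2 * (c p ^ 2 + c p.swap ^ 2)) else 0 := by
      intro q
      have hnn : 0 ≤ s p * (1 / 2 * (c p ^ 2 + c p.swap ^ 2)) :=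
        mul_nonneg (hs0 p) (by positivity)
      by_cases hqp : q = p
      · subst hqp
        have : ∫ ω, centeredProd σ (e ω) q * centeredProd σ (e ω) q ∂ν = s q := by
          simp only [hs, sq]
        rw [this, if_pos rfl]
        split_ifs
        · nlinarith
        · nlinarith
      · by_cases hqs : q = p.swap
        · subst hqs
          have : ∫ ω, centeredProd σ (e ω) p * centeredProd σ (e ω) p.swap ∂ν = s p := by
            simp only [hs, sq, centeredProd_swap]
          rw [this, if_neg hqp, if_pos rfl, zero_add, mul_comm]
          exact mul_le_mul_of_nonneg_left
            (by nlinarith [sq_nonneg (c p - c p.swap)]) (hs0 p)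
        · rw [h.cross p q hqp hqs, if_neg hqp, if_neg hqs]
          simp
    refine (Finset.sum_le_sum fun q _ => hq q).trans ?_
    rw [Finset.sum_add_distrib, Finset.sum_ite_eq', Finset.sum_ite_eq', if_pos (Finset.mem_univ _),
      if_pos (Finset.mem_univ _)]
    have := mul_le_mul_of_nonneg_right (h.fourth p)
      (show 0 ≤ 3 / 2 * c p ^ 2 + 1 / 2 * c p.swap ^ 2 by positivity)
    linarith
  refine (Finset.sum_le_sum fun p _ => hrow p).trans (le_of_eq ?_)
  have hswap : ∑ p : Fin n × Fin n, c p.swap ^ 2 = ∑ p, c p ^ 2 :=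
    Equiv.sum_comp (Equiv.prodComm (Fin n) (Fin n)) fun p => c p ^ 2
  rw [← Finset.mul_sum, Finset.sum_add_distrib, ← Finset.mul_sum, ← Finset.mul_sum, hswap]
  simp only [dotProduct, ← sq]
  ring

/-- The mean squared error of a linear smoother with bias `b`. -/
theorem WhiteNoise.sqNorm_mulVec_sub [IsProbabilityMeasure ν] (h : WhiteNoise ν e σ κ)
    {A : Matrix (Fin n) (Fin n) ℝ} (hA : Aᵀ = A) (b : Fin n → ℝ) :
    Integrable (fun ω => sqNorm (A *ᵥ e ω - b)) ν ∧
      ∫ ω, sqNorm (A *ᵥ e ω - b) ∂ν = sqNorm b + σ ^ 2 * frobSq A := by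
  have h1 : (fun ω => sqNorm (A *ᵥ e ω - b)) = fun ω => (sqNorm b + σ ^ 2 * frobSq A)
      + (fun p : Fin n × Fin n => (A * A) p.1 p.2) ⬝ᵥ centeredProd σ (e ω)
      - 2 * ((A *ᵥ b) ⬝ᵥ e ω) := by
    funext ω
    rw [_root_.sqNorm_mulVec_sub hA _ _ σ, centeredQuad_eq_dotProduct, dotProduct_comm (A *ᵥ b)]
  have i2 : Integrable (fun ω => (fun p : Fin n × Fin n => (A * A) p.1 p.2) ⬝ᵥ
      centeredProd σ (e ω)) ν :=
    (memLp_dotProduct h.memLp_centered _).integrable (by norm_num)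
  have i3 : Integrable (fun ω => 2 * ((A *ᵥ b) ⬝ᵥ e ω)) ν :=
    ((memLp_dotProduct h.memLp _).integrable (by norm_num)).const_mul 2
  have m2 : ∫ ω, (fun p : Fin n × Fin n => (A * A) p.1 p.2) ⬝ᵥ centeredProd σ (e ω) ∂ν = 0 := by
    simp only [dotProduct]
    rw [integral_finsetSum _ fun p _ =>
      ((h.memLp_centered p).integrable (by norm_num)).const_mul _]
    simp [integral_const_mul, h.mean_centered]
  have m3 : ∫ ω, (A *ᵥ b) ⬝ᵥ e ω ∂ν = 0 := by
    simp only [dotProduct]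
    rw [integral_finsetSum _ fun i _ => ((h.memLp i).integrable (by norm_num)).const_mul _]
    simp [integral_const_mul, h.mean]
  have i12 : Integrable (fun ω => (sqNorm b + σ ^ 2 * frobSq A)
      + (fun p : Fin n × Fin n => (A * A) p.1 p.2) ⬝ᵥ centeredProd σ (e ω)) ν :=
    (integrable_const _).add i2
  rw [h1]
  refine ⟨i12.sub i3, ?_⟩
  rw [integral_sub i12 i3, integral_add (integrable_const _) i2, integral_const_mul, m2, m3]
  simp

end WhiteNoise

section Expectations

variable {Ω : Type*} [MeasurableSpace Ω] {ν : Measure Ω} [IsProbabilityMeasure ν] {N L M : ℕ}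
  {e : Ω → Fin N → ℝ} {σ κ : ℝ}

theorem meanLe_noiseEnergy (h : WhiteNoise ν e σ κ) (hκ : 0 ≤ κ)
    (Q : Fin L → Fin M → Matrix (Fin N) (Fin N) ℝ) (u : Fin L → Fin M → ℝ) (μ : Fin N → ℝ) :
    MeanLe ν (fun ω => noiseEnergy σ Q u μ (e ω)) ((σ ^ 2 + 2 * κ) * (L + (L : ℝ) ^ 2)) := by
  have hs := h.secondMomentLe
  have hc := h.secondMomentLe_centered
  have h1 := (hs.meanLe_spanEnergy (sq_nonneg σ) (biasColumns Q u μ)).add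
    (hs.meanLe_spanEnergy (sq_nonneg σ) (smoothedBiasColumns Q u μ))
  have h2 := (hc.meanLe_spanEnergy (by positivity) (vecColumns (groupMat Q u))).add
    (hc.meanLe_spanEnergy (by positivity)
      (vecColumns fun p : Fin L × Fin L => groupMat Q u p.1 * groupMat Q u p.2))
  have h3 := h1.add (h2.const_mul (inv_nonneg.2 (sq_nonneg σ)))
  have he : (fun ω => noiseEnergy σ Q u μ (e ω)) = _ :=
    funext fun ω => by rw [noiseEnergy, div_eq_inv_mul]
  rw [he]
  refine h3.mono_right ?_
  simp only [Fintype.card_fin, Fintype.card_prod, Nat.cast_mul]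
  have hL : (0 : ℝ) ≤ 2 * κ * (L + L * L) := by positivity
  have hσ : (σ ^ 2)⁻¹ * σ ^ 2 ≤ 1 := inv_mul_le_one
  calc _ = σ ^ 2 * (L + L * L) + ((σ ^ 2)⁻¹ * σ ^ 2) * (2 * κ * (L + L * L)) := by ring
    _ ≤ σ ^ 2 * (L + L * L) + 1 * (2 * κ * (L + L * L)) := by gcongr
    _ = _ := by ring

theorem meanLe_sqNorm_add (h : WhiteNoise ν e σ κ) (μ : Fin N → ℝ) :
    MeanLe ν (fun ω => sqNorm (μ + e ω)) (sqNorm μ + σ ^ 2 * N) := by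
  have h1 := h.sqNorm_mulVec_sub (A := 1) Matrix.transpose_one (-μ)
  have hfrob : frobSq (1 : Matrix (Fin N) (Fin N) ℝ) = N := by
    rw [frobSq_of_symm_idem Matrix.transpose_one (Matrix.one_mul 1)]
    simp
  have hneg : sqNorm (-μ) = sqNorm μ := by simp [sqNorm]
  simp only [Matrix.one_mulVec, sub_neg_eq_add, hfrob, hneg, add_comm (e _) μ] at h1
  exact MeanLe.of_integral h1.1 (fun ω => dotProduct_self_nonneg_real _) h1.2.le

/-- The cross terms between weight deviations and errors. -/
theorem meanLe_weightCross (h : WhiteNoise ν e σ κ) (hκ : 0 ≤ κ)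
    {Q : Fin L → Fin M → Matrix (Fin N) (Fin N) ℝ} (hQc : ∀ l m, IsContraction (Q l m))
    (hQf : ∀ l m, frobSq (Q l m) ≤ N) (μ : Fin N → ℝ) {d : Ω → Fin L → Fin M → ℝ} {ρ : ℝ}
    (hd : ∀ l, MeanLe ν (fun ω => sqNorm (d ω l)) ρ) :
    MeanLe ν (fun ω => weightCross σ Q (d ω) μ (e ω))
      (L * (√ρ * √(M * (σ ^ 2 * sqNorm μ)) + √ρ * √(M * (2 * κ * σ ^ 2 * N)))) := by
  have h1 : ∀ l, MeanLe ν (fun ω => ∑ m, (e ω ⬝ᵥ Q l m *ᵥ μ) ^ 2)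
      (M * (σ ^ 2 * sqNorm μ)) := by
    intro l
    have := MeanLe.sum (Finset.univ : Finset (Fin M)) fun m _ =>
      (h.secondMomentLe.meanLe_sq (Q l m *ᵥ μ)).mono_right
        (mul_le_mul_of_nonneg_left (hQc l m μ) (sq_nonneg σ))
    simpa only [dotProduct_comm _ (e _), sqNorm, Finset.sum_const, Finset.card_univ, Fintype.card_fin,
      nsmul_eq_mul] using this
  have h2 : ∀ l, MeanLe ν (fun ω => ∑ m, centeredQuad σ (e ω) (Q l m) ^ 2)
      (M * (2 * κ * σ ^ 2 * N)) := by
    intro l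
    have := MeanLe.sum (Finset.univ : Finset (Fin M)) fun m _ =>
      (h.secondMomentLe_centered.meanLe_sq (fun p => Q l m p.1 p.2)).mono_right
        (b := 2 * κ * σ ^ 2 * _) (a := 2 * κ * σ ^ 2 * N)
        (mul_le_mul_of_nonneg_left (by
          refine le_trans (le_of_eq ?_) (hQf l m)
          simp only [frobSq, dotProduct, Fintype.sum_prod_type, sq]) (by positivity))
    simpa only [← centeredQuad_eq_dotProduct, Finset.sum_const, Finset.card_univ,
      Fintype.card_fin, nsmul_eq_mul] using this
  have h3 := MeanLe.sum (Finset.univ : Finset (Fin L)) fun l _ =>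
    ((hd l).sqrt_mul_sqrt (h1 l)).add ((hd l).sqrt_mul_sqrt (h2 l))
  simpa only [weightCross, Finset.sum_const, Finset.card_univ, Fintype.card_fin,
    nsmul_eq_mul] using h3

/-- The effect of the weight deviations on the fit. -/
theorem meanLe_sqrt_weightFit (h : WhiteNoise ν e σ κ) (μ : Fin N → ℝ)
    {d : Ω → Fin L → Fin M → ℝ} {ρ : ℝ} (hd : ∀ l, MeanLe ν (fun ω => sqNorm (d ω l)) ρ) :
    MeanLe ν (fun ω => √(M * (∑ l, sqNorm (d ω l)) * sqNorm (μ + e ω)))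
      (√(M * (L * ρ)) * √(sqNorm μ + σ ^ 2 * N)) := by
  have h1 := (MeanLe.sum (Finset.univ : Finset (Fin L)) fun l _ => hd l).const_mul
    (Nat.cast_nonneg (α := ℝ) M)
  have h2 := h1.sqrt_mul_sqrt (meanLe_sqNorm_add h μ)
  simp only [Finset.sum_const, Finset.card_univ, Fintype.card_fin, nsmul_eq_mul] at h2
  refine h2.mono ?_ (fun ω => Real.sqrt_nonneg _) (fun ω => ?_) le_rfl
  · exact (h1.aemeasurable.mul (meanLe_sqNorm_add h μ).aemeasurable).sqrt
  · rw [Real.sqrt_mul (h1.nonneg ω)]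

/-- Jensen's inequality for the squared norms of the weight deviations. -/
theorem meanLe_of_sq {f : Ω → ℝ} {a : ℝ} (hf : AEMeasurable f ν) (hf0 : ∀ ω, 0 ≤ f ω)
    (ha : 0 ≤ a) (h : ∫⁻ ω, ENNReal.ofReal (f ω ^ 2) ∂ν ≤ ENNReal.ofReal a) :
    MeanLe ν f (√a) := by
  have h1 : MeanLe ν (fun ω => f ω ^ 2) a := ⟨hf.pow_const 2, fun ω => sq_nonneg _, ha, h⟩
  have h2 := h1.sqrt_mul_sqrt (MeanLe.const (ν := ν) zero_le_one)
  simpa only [Real.sqrt_sq (hf0 _), Real.sqrt_one, mul_one] using h2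

end Expectations

/-! ### Conditional moments of the errors given the design -/

section CondIndep

variable {Ω α β γ : Type*} [MeasurableSpace Ω] [StandardBorelSpace Ω] {P : Measure Ω}
  [IsProbabilityMeasure P] [MeasurableSpace α]
  [MeasurableSpace β] [StandardBorelSpace β] [Nonempty β]
  [MeasurableSpace γ] [StandardBorelSpace γ] [Nonempty γ]
  {k : Ω → α} {f : Ω → β} {g : Ω → γ}

/-- Conditioning on a variable that is conditionally independent of `f` given `k`, in addition to
`k`, does not change conditional expectations of functions of `f`. -/
theorem condExp_comp_of_condIndepFun (hk : Measurable k) (hf : Measurable f) (hg : Measurable g)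
    (h : CondIndepFun (MeasurableSpace.comap k inferInstance) hk.comap_le g f P)
    {φ : β → ℝ} (hφ : StronglyMeasurable φ) (hint : Integrable (fun ω => φ (f ω)) P) :
    P[fun ω => φ (f ω) | MeasurableSpace.comap (fun ω => (k ω, g ω)) inferInstance]
      =ᵐ[P] P[fun ω => φ (f ω) | MeasurableSpace.comap k inferInstance] := by
  have h1 := (condIndepFun_iff_condDistrib_prod_ae_eq_prodMkRight hf hg hk).1 h
  have h2 := ae_of_ae_map (hk.prodMk hg).aemeasurable h1
  have h3 := condExp_ae_eq_integral_condDistrib (hk.prodMk hg) hf.aemeasurable hφ hint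
  have h4 := condExp_ae_eq_integral_condDistrib hk hf.aemeasurable hφ hint
  filter_upwards [h2, h3, h4] with ω e2 e3 e4
  rw [e3, e4, e2, Kernel.prodMkRight_apply]

/-- The product of a conditionally centred variable with a conditionally independent one is
conditionally centred. -/
theorem condExp_mul_eq_zero_of_condIndepFun (hk : Measurable k) (hf : Measurable f)
    (hg : Measurable g)
    (h : CondIndepFun (MeasurableSpace.comap k inferInstance) hk.comap_le g f P)
    {φ : β → ℝ} (hφ : StronglyMeasurable φ) (hint : Integrable (fun ω => φ (f ω)) P)
    {ψ : γ → ℝ} (hψ : Measurable ψ) (hprod : Integrable (fun ω => φ (f ω) * ψ (g ω)) P)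
    (h0 : P[fun ω => φ (f ω) | MeasurableSpace.comap k inferInstance] =ᵐ[P] 0) :
    P[fun ω => φ (f ω) * ψ (g ω) | MeasurableSpace.comap k inferInstance] =ᵐ[P] 0 := by
  have hle : MeasurableSpace.comap k inferInstance
      ≤ MeasurableSpace.comap (fun ω => (k ω, g ω)) inferInstance := by
    have : Measurable[MeasurableSpace.comap (fun ω => (k ω, g ω)) inferInstance] k :=
      measurable_fst.comp (comap_measurable _)
    exact this.comap_le
  have hψg : StronglyMeasurable[MeasurableSpace.comap (fun ω => (k ω, g ω)) inferInstance]
      (fun ω => ψ (g ω)) :=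
    ((hψ.comp measurable_snd).comp (comap_measurable _)).stronglyMeasurable
  have h1 := condExp_mul_of_stronglyMeasurable_right hψg hprod hint
  have h2 := (condExp_comp_of_condIndepFun hk hf hg h hφ hint).trans h0
  have h3 : P[fun ω => φ (f ω) * ψ (g ω) |
      MeasurableSpace.comap (fun ω => (k ω, g ω)) inferInstance] =ᵐ[P] 0 := by
    refine h1.trans ?_
    filter_upwards [h2] with ω e2
    simp [e2]
  have h4 := condExp_condExp_of_le (f := fun ω => φ (f ω) * ψ (g ω)) (μ := P) hle
    (hk.prodMk hg).comap_le
  refine h4.symm.trans ((condExp_congr_ae h3).trans ?_)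
  rw [condExp_zero]

end CondIndep

section CondMoments

variable {Ω α : Type*} [MeasurableSpace Ω] [MeasurableSpace α] {P : Measure Ω} {n : ℕ}
  {X : Ω → α} {e : Ω → Fin n → ℝ} {σ C₄ : ℝ}

theorem measurable_centeredProd (σ : ℝ) (p : Fin n × Fin n) :
    Measurable fun x : Fin n → ℝ => centeredProd σ x p := by
  unfold centeredProd
  fun_prop

/-- The errors are, given `X`, independent and centred with variance `σ²` and fourth moments at
most `C₄`. -/
structure CondErrors [StandardBorelSpace Ω] (P : Measure Ω) [IsFiniteMeasure P] {X : Ω → α}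
    (hX : Measurable X) (e : Ω → Fin n → ℝ) (σ C₄ : ℝ) : Prop where
  measurable : Measurable e
  memLp : ∀ i, MemLp (fun ω => e ω i) 4 P
  mean : ∀ i, P[fun ω => e ω i | MeasurableSpace.comap X inferInstance] =ᵐ[P] fun _ => 0
  var : ∀ i, P[fun ω => e ω i ^ 2 | MeasurableSpace.comap X inferInstance] =ᵐ[P] fun _ => σ ^ 2
  fourth : ∀ i, P[fun ω => e ω i ^ 4 | MeasurableSpace.comap X inferInstance] ≤ᵐ[P] fun _ => C₄
  indep : iCondIndepFun (MeasurableSpace.comap X inferInstance) hX.comap_le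
    (fun i ω => e ω i) P

namespace CondErrors

variable [StandardBorelSpace Ω] [IsProbabilityMeasure P] {hX : Measurable X}

theorem memLp_two (h : CondErrors P hX e σ C₄) (i : Fin n) : MemLp (fun ω => e ω i) 2 P :=
  (h.memLp i).mono_exponent (by norm_num)

theorem memLp_mul (h : CondErrors P hX e σ C₄) (i j : Fin n) :
    MemLp (fun ω => e ω i * e ω j) 2 P := by
  have : ENNReal.HolderTriple 4 4 2 := ⟨by
    rw [← two_mul, show (4 : ℝ≥0∞) = 2 * 2 by norm_num, ENNReal.mul_inv (by simp) (by simp),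
      ← mul_assoc, ENNReal.mul_inv_cancel (by simp) (by simp), one_mul]⟩
  exact (h.memLp j).mul' (h.memLp i)

theorem memLp_centered (h : CondErrors P hX e σ C₄) (p : Fin n × Fin n) :
    MemLp (fun ω => centeredProd σ (e ω) p) 2 P :=
  (h.memLp_mul p.1 p.2).sub (memLp_const _)

/-- A conditionally centred function of one error, times a function of the other errors, is
conditionally centred. -/
theorem condExp_mul_others (h : CondErrors P hX e σ C₄) (i : Fin n) {φ : ℝ → ℝ}
    (hφ : Measurable φ) {ψ : (({i}ᶜ : Finset (Fin n)) → ℝ) → ℝ} (hψ : Measurable ψ)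
    (hint : Integrable (fun ω => φ (e ω i)) P)
    (hprod : Integrable (fun ω => φ (e ω i) * ψ (fun j => e ω j)) P)
    (h0 : P[fun ω => φ (e ω i) | MeasurableSpace.comap X inferInstance] =ᵐ[P] 0) :
    P[fun ω => φ (e ω i) * ψ (fun j => e ω j) | MeasurableSpace.comap X inferInstance]
      =ᵐ[P] 0 := by
  have hm : ∀ j, Measurable fun ω => e ω j := fun j => (measurable_pi_apply j).comp h.measurable
  have h1 := (h.indep.condIndepFun_finset {i} {i}ᶜ
    disjoint_compl_right hm).symm
  exact condExp_mul_eq_zero_of_condIndepFun hX (f := fun ω (j : ({i} : Finset (Fin n))) => e ω j)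
    (g := fun ω (j : ({i}ᶜ : Finset (Fin n))) => e ω j)
    (measurable_pi_lambda _ fun j => hm j) (measurable_pi_lambda _ fun j => hm j) h1
    (φ := fun x => φ (x ⟨i, by simp⟩)) (hφ.comp (measurable_pi_apply _)).stronglyMeasurable hint
    hψ hprod h0

theorem condExp_sq_sub (h : CondErrors P hX e σ C₄) (i : Fin n) :
    P[fun ω => e ω i ^ 2 - σ ^ 2 | MeasurableSpace.comap X inferInstance] =ᵐ[P] 0 := by
  have h1 := condExp_sub (h.memLp_two i).integrable_sq (integrable_const (σ ^ 2))
    (MeasurableSpace.comap X inferInstance) (μ := P)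
  refine h1.trans ?_
  rw [condExp_const hX.comap_le]
  filter_upwards [h.var i] with ω hω
  simp [hω]

theorem condExp_centered (h : CondErrors P hX e σ C₄) (p : Fin n × Fin n) :
    P[fun ω => centeredProd σ (e ω) p | MeasurableSpace.comap X inferInstance] =ᵐ[P] 0 := by
  obtain ⟨i, j⟩ := p
  by_cases hij : i = j
  · subst hij
    simpa only [centeredProd, if_true, ← sq] using h.condExp_sq_sub i
  · have hj : j ∈ ({i}ᶜ : Finset (Fin n)) := by simpa using Ne.symm hij
    simpa only [centeredProd, if_neg hij, sub_zero, id] using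
      h.condExp_mul_others i (φ := id) measurable_id (ψ := fun x => x ⟨j, hj⟩)
        (measurable_pi_apply _) ((h.memLp_two i).integrable (by norm_num))
        ((h.memLp_mul i j).integrable (by norm_num)) (h.mean i)

theorem condExp_cross_of_lone (h : CondErrors P hX e σ C₄) {i j k l : Fin n} (hij : i ≠ j)
    (hik : i ≠ k) (hil : i ≠ l) :
    P[fun ω => centeredProd σ (e ω) (i, j) * centeredProd σ (e ω) (k, l) |
      MeasurableSpace.comap X inferInstance] =ᵐ[P] 0 := by
  have hj : j ∈ ({i}ᶜ : Finset (Fin n)) := by simpa using hij.symm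
  have hk : k ∈ ({i}ᶜ : Finset (Fin n)) := by simpa using hik.symm
  have hl : l ∈ ({i}ᶜ : Finset (Fin n)) := by simpa using hil.symm
  have heq : (fun ω => centeredProd σ (e ω) (i, j) * centeredProd σ (e ω) (k, l))
      = fun ω => id (e ω i) * (e ω j * centeredProd σ (e ω) (k, l)) := by
    funext ω
    simp only [centeredProd, if_neg hij, sub_zero, id]
    ring
  have hint : Integrable
      (fun ω => centeredProd σ (e ω) (i, j) * centeredProd σ (e ω) (k, l)) P :=
    (h.memLp_centered (i, j)).integrable_mul (h.memLp_centered (k, l))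
  rw [heq] at hint ⊢
  exact h.condExp_mul_others i (φ := id) measurable_id
    (ψ := fun x => x ⟨j, hj⟩ * (x ⟨k, hk⟩ * x ⟨l, hl⟩ - if k = l then σ ^ 2 else 0))
    (by fun_prop) ((h.memLp_two i).integrable (by norm_num)) hint (h.mean i)

theorem condExp_cross_diag (h : CondErrors P hX e σ C₄) {i k : Fin n} (hik : i ≠ k) :
    P[fun ω => centeredProd σ (e ω) (i, i) * centeredProd σ (e ω) (k, k) |
      MeasurableSpace.comap X inferInstance] =ᵐ[P] 0 := by
  have hk : k ∈ ({i}ᶜ : Finset (Fin n)) := by simpa using hik.symm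
  have heq : (fun ω => centeredProd σ (e ω) (i, i) * centeredProd σ (e ω) (k, k))
      = fun ω => (e ω i ^ 2 - σ ^ 2) * (e ω k ^ 2 - σ ^ 2) := by
    funext ω
    simp only [centeredProd, if_true]
    ring
  have hint : Integrable
      (fun ω => centeredProd σ (e ω) (i, i) * centeredProd σ (e ω) (k, k)) P :=
    (h.memLp_centered (i, i)).integrable_mul (h.memLp_centered (k, k))
  rw [heq] at hint ⊢
  exact h.condExp_mul_others i (φ := fun x => x ^ 2 - σ ^ 2) (by fun_prop)
    (ψ := fun x => x ⟨k, hk⟩ ^ 2 - σ ^ 2) (by fun_prop)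
    ((h.memLp_two i).integrable_sq.sub (integrable_const _)) hint (h.condExp_sq_sub i)

/-- Centred products with different index pairs are conditionally uncorrelated. -/
theorem condExp_cross (h : CondErrors P hX e σ C₄) {p q : Fin n × Fin n} (hpq : q ≠ p)
    (hpq' : q ≠ p.swap) :
    P[fun ω => centeredProd σ (e ω) p * centeredProd σ (e ω) q |
      MeasurableSpace.comap X inferInstance] =ᵐ[P] 0 := by
  obtain ⟨i, j⟩ := p
  obtain ⟨k, l⟩ := q
  have sw : ∀ (a b : Fin n) ω, centeredProd σ (e ω) (a, b) = centeredProd σ (e ω) (b, a) :=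
    fun a b ω => centeredProd_swap σ (e ω) (b, a)
  simp only [ne_eq, Prod.mk.injEq, Prod.swap_prod_mk, not_and] at hpq hpq'
  by_cases hij : i = j
  · subst hij
    by_cases hkl : k = l
    · subst hkl
      exact h.condExp_cross_diag fun hik => hpq hik.symm hik.symm
    · simp only [mul_comm (centeredProd σ (e _) (i, i))]
      by_cases hki : k = i
      · simp only [sw k l]
        have hli : l ≠ i := fun hli => hkl (hki.trans hli.symm)
        exact h.condExp_cross_of_lone (Ne.symm hkl) hli hli
      · exact h.condExp_cross_of_lone hkl hki hki
  · by_cases hi : i ≠ k ∧ i ≠ l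
    · exact h.condExp_cross_of_lone hij hi.1 hi.2
    · have hj : j ≠ k ∧ j ≠ l := by
        constructor
        · rintro rfl
          exact hi ⟨hij, fun hil => hpq' rfl hil.symm⟩
        · rintro rfl
          exact hi ⟨fun hik => hpq hik.symm rfl, hij⟩
      simp only [sw i j]
      exact h.condExp_cross_of_lone (Ne.symm hij) hj.1 hj.2

theorem ae_eq_zero (h : CondErrors P hX e σ C₄) (hσ : σ = 0) : ∀ᵐ ω ∂P, e ω = 0 := by
  have h1 : ∀ i, ∀ᵐ ω ∂P, e ω i = 0 := by
    intro i
    have h2 : ∫ ω, e ω i ^ 2 ∂P = 0 := by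
      rw [← integral_condExp hX.comap_le, integral_congr_ae (h.var i), hσ]
      simp
    rw [integral_eq_zero_iff_of_nonneg (fun ω => sq_nonneg _) (h.memLp_two i).integrable_sq] at h2
    filter_upwards [h2] with ω hω
    simpa using hω
  filter_upwards [ae_all_iff.2 h1] with ω hω
  exact funext hω

theorem condExp_centered_sq_le (h : CondErrors P hX e σ C₄) (p : Fin n × Fin n) :
    P[fun ω => centeredProd σ (e ω) p ^ 2 | MeasurableSpace.comap X inferInstance]
      ≤ᵐ[P] fun _ => (σ ^ 2 + |C₄| / σ ^ 2) * σ ^ 2 := by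
  rcases eq_or_ne σ 0 with hσ | hσ
  · have h1 : (fun ω => centeredProd σ (e ω) p ^ 2) =ᵐ[P] 0 := by
      filter_upwards [h.ae_eq_zero hσ] with ω hω
      simp [centeredProd, hω, hσ]
    refine (condExp_congr_ae h1).le.trans ?_
    rw [condExp_zero, hσ]
    exact Eventually.of_forall fun ω => by simp
  have hC : (σ ^ 2 + |C₄| / σ ^ 2) * σ ^ 2 = σ ^ 4 + |C₄| := by
    field_simp
  rw [hC]
  obtain ⟨i, j⟩ := p
  by_cases hij : i = j
  · subst hij
    have hi4 : Integrable (fun ω => e ω i ^ 4) P := by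
      have := (h.memLp_mul i i).integrable_sq
      refine this.congr (Eventually.of_forall fun ω => ?_)
      ring
    have heq : (fun ω => centeredProd σ (e ω) (i, i) ^ 2) =
        (fun ω => e ω i ^ 4) - ((2 * σ ^ 2) • (fun ω => e ω i ^ 2 - σ ^ 2) + fun _ => σ ^ 4) := by
      funext ω
      simp only [centeredProd, if_true, Pi.sub_apply, Pi.add_apply, Pi.smul_apply, smul_eq_mul]
      ring
    have h2 : Integrable (fun ω => e ω i ^ 2 - σ ^ 2) P :=
      (h.memLp_two i).integrable_sq.sub (integrable_const _)
    rw [heq]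
    have c1 := condExp_sub hi4 ((h2.smul (2 * σ ^ 2)).add (integrable_const (σ ^ 4)))
      (MeasurableSpace.comap X inferInstance) (μ := P)
    have c2 := condExp_add (h2.smul (2 * σ ^ 2)) (integrable_const (σ ^ 4))
      (MeasurableSpace.comap X inferInstance) (μ := P)
    have c3 := condExp_smul (2 * σ ^ 2) (fun ω => e ω i ^ 2 - σ ^ 2)
      (MeasurableSpace.comap X inferInstance) (μ := P)
    rw [condExp_const hX.comap_le] at c2
    filter_upwards [c1, c2, c3, h.condExp_sq_sub i, h.fourth i] with ω e1 e2 e3 e4 e5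
    rw [e1, Pi.sub_apply, e2, Pi.add_apply, e3, Pi.smul_apply, e4]
    have := le_abs_self C₄
    have h4 : 0 ≤ σ ^ 4 := by positivity
    simp only [Pi.zero_apply, smul_zero, zero_add]
    linarith
  · have hj : j ∈ ({i}ᶜ : Finset (Fin n)) := by simpa using Ne.symm hij
    have h2 := (h.memLp_two j).integrable_sq
    have hint : Integrable (fun ω => (e ω i ^ 2 - σ ^ 2) * e ω j ^ 2) P := by
      refine ((h.memLp_mul i j).integrable_sq.sub (h2.const_mul (σ ^ 2))).congr
        (Eventually.of_forall fun ω => ?_)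
      simp only [Pi.sub_apply]
      ring
    have heq : (fun ω => centeredProd σ (e ω) (i, j) ^ 2) =
        (fun ω => (e ω i ^ 2 - σ ^ 2) * e ω j ^ 2) + σ ^ 2 • fun ω => e ω j ^ 2 := by
      funext ω
      simp only [centeredProd, if_neg hij, Pi.add_apply, Pi.smul_apply, smul_eq_mul]
      ring
    rw [heq]
    have c1 := condExp_add hint (h2.smul (σ ^ 2))
      (MeasurableSpace.comap X inferInstance) (μ := P)
    have c2 := condExp_smul (σ ^ 2) (fun ω => e ω j ^ 2)
      (MeasurableSpace.comap X inferInstance) (μ := P)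
    have c3 := h.condExp_mul_others i (φ := fun x => x ^ 2 - σ ^ 2) (by fun_prop)
      (ψ := fun x => x ⟨j, hj⟩ ^ 2) (by fun_prop)
      ((h.memLp_two i).integrable_sq.sub (integrable_const _)) hint (h.condExp_sq_sub i)
    filter_upwards [c1, c2, c3, h.var j] with ω e1 e2 e3 e4
    rw [e1, Pi.add_apply, e2, Pi.smul_apply, e4, e3]
    have := abs_nonneg C₄
    simp only [Pi.zero_apply, zero_add, smul_eq_mul]
    nlinarith

/-- Given `X` and a variable `S` that is conditionally independent of the errors given `X`, the
errors are almost surely white noise. -/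
theorem ae_whiteNoise (h : CondErrors P hX e σ C₄) {γ : Type*} [MeasurableSpace γ]
    [StandardBorelSpace γ] [Nonempty γ] {S : Ω → γ} (hS : Measurable S)
    (hindep : CondIndepFun (MeasurableSpace.comap X inferInstance) hX.comap_le S e P) :
    ∀ᵐ ω ∂P, WhiteNoise
      (condExpKernel P (MeasurableSpace.comap (fun ω => (X ω, S ω)) inferInstance) ω) e σ
      (σ ^ 2 + |C₄| / σ ^ 2) := by
  have hle := (hX.prodMk hS).comap_le
  have key : ∀ φ : (Fin n → ℝ) → ℝ, Measurable φ → Integrable (fun ω => φ (e ω)) P →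
      ∀ᵐ ω ∂P, P[fun ω => φ (e ω) | MeasurableSpace.comap X inferInstance] ω = ∫ ω', φ (e ω')
        ∂(condExpKernel P (MeasurableSpace.comap (fun ω => (X ω, S ω)) inferInstance) ω) := by
    intro φ hφ hint
    filter_upwards [condExp_comp_of_condIndepFun hX h.measurable hS hindep
      hφ.stronglyMeasurable hint, condExp_ae_eq_integral_condExpKernel hle hint] with ω h1 h2
    rw [← h1, h2]
  have hη := measurable_centeredProd (n := n) σ
  have a1 := ae_all_iff.2 fun i => (h.memLp_two i).integrable_sq.condExpKernel_ae
    (m := MeasurableSpace.comap (fun ω => (X ω, S ω)) inferInstance)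
  have a2 := ae_all_iff.2 fun p => (h.memLp_centered p).integrable_sq.condExpKernel_ae
    (m := MeasurableSpace.comap (fun ω => (X ω, S ω)) inferInstance)
  have a3 := ae_all_iff.2 fun i => key (fun x => x i) (measurable_pi_apply i)
    ((h.memLp_two i).integrable (by norm_num))
  have a3' := ae_all_iff.2 h.mean
  have a4 := ae_all_iff.2 fun p => key (fun x => centeredProd σ x p) (hη p)
    ((h.memLp_centered p).integrable (by norm_num))
  have a4' := ae_all_iff.2 h.condExp_centered
  have a5 := ae_all_iff.2 fun p => ae_all_iff.2 fun q =>
    key (fun x => centeredProd σ x p * centeredProd σ x q) ((hη p).mul (hη q))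
      ((h.memLp_centered p).integrable_mul (h.memLp_centered q))
  have a5' : ∀ᵐ ω ∂P, ∀ p q : Fin n × Fin n, q ≠ p → q ≠ p.swap →
      P[fun ω => centeredProd σ (e ω) p * centeredProd σ (e ω) q |
        MeasurableSpace.comap X inferInstance] ω = 0 := by
    refine ae_all_iff.2 fun p => ae_all_iff.2 fun q => ?_
    by_cases h1 : q = p
    · exact Eventually.of_forall fun ω h2 => absurd h1 h2
    by_cases h2 : q = p.swap
    · exact Eventually.of_forall fun ω _ h3 => absurd h2 h3
    filter_upwards [h.condExp_cross h1 h2] with ω hω _ _ using hω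
  have a6 := ae_all_iff.2 fun p => key (fun x => centeredProd σ x p ^ 2) ((hη p).pow_const 2)
    (h.memLp_centered p).integrable_sq
  have a6' := ae_all_iff.2 h.condExp_centered_sq_le
  filter_upwards [a1, a2, a3, a3', a4, a4', a5, a5', a6, a6']
    with ω b1 b2 b3 b3' b4 b4' b5 b5' b6 b6'
  refine ⟨fun i => ?_, fun p => ?_, fun i => ?_, fun p => ?_, fun p q h1 h2 => ?_, fun p => ?_⟩
  · exact (memLp_two_iff_integrable_sq
      ((measurable_pi_apply i).comp h.measurable).aestronglyMeasurable).2 (b1 i)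
  · exact (memLp_two_iff_integrable_sq
      ((hη p).comp h.measurable).aestronglyMeasurable).2 (b2 p)
  · rw [← b3 i, b3' i]
  · rw [← b4 p, b4' p]
    rfl
  · rw [← b5 p q, b5' p q h1 h2]
  · rw [← b6 p]
    exact b6' p

end CondErrors

end CondMoments

/-! ### Measurability -/

section Measurability

variable {m n k : Type*}

theorem isClosed_isMoorePenrose [Fintype m] [Fintype n] :
    IsClosed {p : (m → n → ℝ) × (n → m → ℝ) |
      IsMoorePenrose (Matrix.of p.1) (Matrix.of p.2)} := by
  have h : {p : (m → n → ℝ) × (n → m → ℝ) | IsMoorePenrose (Matrix.of p.1) (Matrix.of p.2)}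
      = {p | (∀ i j, ∑ b, (∑ a, p.1 i a * p.2 a b) * p.1 b j = p.1 i j) ∧
          (∀ i j, ∑ b, (∑ a, p.2 i a * p.1 a b) * p.2 b j = p.2 i j) ∧
          (∀ i j, ∑ a, p.1 j a * p.2 a i = ∑ a, p.1 i a * p.2 a j) ∧
          ∀ i j, ∑ a, p.2 j a * p.1 a i = ∑ a, p.2 i a * p.1 a j} := by
    ext p
    simp only [IsMoorePenrose, ← Matrix.ext_iff, Matrix.mul_apply, Matrix.transpose_apply,
      Matrix.of_apply, Set.mem_ofPred_eq]
  rw [h]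
  simp only [Set.ofPred_and, Set.ofPred_forall]
  refine IsClosed.inter ?_ (IsClosed.inter ?_ (IsClosed.inter ?_ ?_)) <;>
    exact isClosed_iInter fun i => isClosed_iInter fun j =>
      isClosed_eq (by fun_prop) (by fun_prop)

/-- The Moore-Penrose inverse is a Borel function of the matrix: its graph is closed, and the
projection of the graph to the first factor is injective, so that the Lusin-Souslin theorem
applies. -/
theorem measurable_pinv [Fintype m] [Fintype n] :
    Measurable fun A : m → n → ℝ => fun i j => pinv (Matrix.of A) i j := by
  intro B hB
  have h : (fun A : m → n → ℝ => fun i j => pinv (Matrix.of A) i j) ⁻¹' B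
      = Prod.fst '' ({p : (m → n → ℝ) × (n → m → ℝ) |
        IsMoorePenrose (Matrix.of p.1) (Matrix.of p.2)} ∩ Prod.snd ⁻¹' B) := by
    ext A
    constructor
    · intro hA
      exact ⟨(A, fun i j => pinv (Matrix.of A) i j), ⟨pinv_spec (Matrix.of A), hA⟩, rfl⟩
    · rintro ⟨⟨A', G⟩, ⟨hG, hGB⟩, rfl⟩
      have : pinv (Matrix.of A') = Matrix.of G := (pinv_spec _).unique hG
      simp only [Set.mem_preimage, this]
      exact hGB
  rw [h]
  refine (isClosed_isMoorePenrose.measurableSet.inter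
    (measurable_snd hB)).image_of_continuousOn_injOn continuous_fst.continuousOn ?_
  rintro ⟨A, G⟩ ⟨hG, -⟩ ⟨A', G'⟩ ⟨hG', -⟩ (rfl : A = A')
  have : Matrix.of G = Matrix.of G' := IsMoorePenrose.unique hG hG'
  exact Prod.ext rfl (Matrix.of.injective this)

variable {Ω : Type*} [MeasurableSpace Ω]

/-- A random matrix, measurable entry by entry. -/
def MeasurableEntries (A : Ω → Matrix m n ℝ) : Prop :=
  ∀ i j, Measurable fun ω => A ω i j

theorem MeasurableEntries.mul [Fintype n] {A : Ω → Matrix m n ℝ} {B : Ω → Matrix n k ℝ}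
    (hA : MeasurableEntries A) (hB : MeasurableEntries B) :
    MeasurableEntries fun ω => A ω * B ω := fun i j => by
  simp only [Matrix.mul_apply]
  exact Finset.measurable_sum _ fun a _ => (hA i a).mul (hB a j)

theorem MeasurableEntries.transpose {A : Ω → Matrix m n ℝ} (hA : MeasurableEntries A) :
    MeasurableEntries fun ω => (A ω)ᵀ :=
  fun i j => hA j i

theorem MeasurableEntries.mulVec [Fintype n] {A : Ω → Matrix m n ℝ} (hA : MeasurableEntries A)
    {v : Ω → n → ℝ} (hv : Measurable v) : Measurable fun ω => A ω *ᵥ v ω := by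
  refine measurable_pi_lambda _ fun i => ?_
  simp only [Matrix.mulVec, dotProduct]
  exact Finset.measurable_sum _ fun a _ => (hA i a).mul ((measurable_pi_apply a).comp hv)

theorem measurable_dotProduct [Fintype n] {v w : Ω → n → ℝ} (hv : Measurable v) (hw : Measurable w) :
    Measurable fun ω => v ω ⬝ᵥ w ω := by
  simp only [dotProduct]
  exact Finset.measurable_sum _ fun a _ =>
    ((measurable_pi_apply a).comp hv).mul ((measurable_pi_apply a).comp hw)

theorem MeasurableEntries.sum_smul {κ : Type*} [Fintype κ] {c : Ω → κ → ℝ} (hc : Measurable c)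
    {A : κ → Ω → Matrix m n ℝ} (hA : ∀ a, MeasurableEntries (A a)) :
    MeasurableEntries fun ω => ∑ a, c ω a • A a ω := fun i j => by
  simp only [Matrix.sum_apply, Matrix.smul_apply, smul_eq_mul]
  exact Finset.measurable_sum _ fun a _ => ((measurable_pi_apply a).comp hc).mul (hA a i j)

theorem MeasurableEntries.projMat [Fintype m] [Fintype n] {A : Ω → Matrix m n ℝ} (hA : MeasurableEntries A) :
    MeasurableEntries fun ω => projMat (A ω) := by
  have hS := hA.transpose.mul hA
  have hG : MeasurableEntries fun ω => pinv ((A ω)ᵀ * A ω) := by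
    intro i j
    have h1 : Measurable fun ω => fun i j => ((A ω)ᵀ * A ω) i j :=
      measurable_pi_lambda _ fun i => measurable_pi_lambda _ fun j => hS i j
    exact (measurable_pi_apply j).comp ((measurable_pi_apply i).comp (measurable_pinv.comp h1))
  exact (hA.mul hG).mul hA.transpose

theorem MeasurableEntries.frobSq [Fintype m] [Fintype n] {A : Ω → Matrix m n ℝ} (hA : MeasurableEntries A) :
    Measurable fun ω => frobSq (A ω) := by
  simp only [_root_.frobSq]
  exact Finset.measurable_sum _ fun i _ => Finset.measurable_sum _ fun j _ => (hA i j).pow_const 2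

theorem MeasurableEntries.spanEnergy [Fintype m] [Fintype n] {A : Ω → Matrix m n ℝ}
    (hA : MeasurableEntries A) {z : Ω → m → ℝ} (hz : Measurable z) : Measurable fun ω => spanEnergy (A ω) (z ω) :=
  measurable_dotProduct (hA.projMat.mulVec hz) (hA.projMat.mulVec hz)

theorem measurableEntries_modelProj {N K : ℕ} {X : Ω → Fin N → Fin K → ℝ} (hX : Measurable X)
    {s : Ω → Fin K → Bool} (hs : Measurable s) :
    MeasurableEntries fun ω => modelProj (X ω) (s ω) := by
  refine MeasurableEntries.projMat (MeasurableEntries.mul (fun i j => ?_) fun i j => ?_)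
  · exact (measurable_pi_apply j).comp ((measurable_pi_apply i).comp hX)
  · simp only [selMat, Matrix.diagonal_apply]
    by_cases hij : i = j
    · simp only [if_pos hij]
      exact (measurable_from_top (f := fun b : Bool => if b then (1 : ℝ) else 0)).comp
        ((measurable_pi_apply i).comp hs)
    · simp only [if_neg hij]
      exact measurable_const

variable {N L M : ℕ} {Q : Ω → Fin L → Fin M → Matrix (Fin N) (Fin N) ℝ}
  {u : Ω → Fin L → Fin M → ℝ} {μ e : Ω → Fin N → ℝ} {σ : ℝ}

theorem measurableEntries_groupMat (hQ : ∀ l m, MeasurableEntries fun ω => Q ω l m)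
    (hu : Measurable u) (l : Fin L) : MeasurableEntries fun ω => groupMat (Q ω) (u ω) l :=
  MeasurableEntries.sum_smul ((measurable_pi_apply l).comp hu) fun m => hQ l m

theorem measurable_fixedRisk (hQ : ∀ l m, MeasurableEntries fun ω => Q ω l m)
    (hu : Measurable u) (hμ : Measurable μ) (w : Fin L → ℝ) :
    Measurable fun ω => fixedRisk σ (Q ω) (u ω) (μ ω) w := by
  have hA : MeasurableEntries fun ω => avgMat (Q ω) (u ω) w :=
    MeasurableEntries.sum_smul measurable_const fun l => measurableEntries_groupMat hQ hu l
  have hb := hμ.sub (hA.mulVec hμ)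
  exact (measurable_dotProduct hb hb).add (hA.frobSq.const_mul _)

theorem continuous_fixedRisk (σ : ℝ) (Q : Fin L → Fin M → Matrix (Fin N) (Fin N) ℝ)
    (u : Fin L → Fin M → ℝ) (μ : Fin N → ℝ) : Continuous (fixedRisk σ Q u μ) := by
  unfold fixedRisk
  simp only [sqNorm, frobSq, avgMat, dotProduct, Matrix.mulVec, Pi.sub_apply,
    Matrix.sum_apply, Matrix.smul_apply, smul_eq_mul]
  fun_prop

/-- The minimum of `fixedRisk` over the simplex. -/
noncomputable def minFixedRisk (σ : ℝ) (Q : Fin L → Fin M → Matrix (Fin N) (Fin N) ℝ)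
    (u : Fin L → Fin M → ℝ) (μ : Fin N → ℝ) : ℝ :=
  ⨅ w : stdSimplex ℝ (Fin L), fixedRisk σ Q u μ w.1

theorem bddBelow_fixedRisk (σ : ℝ) (Q : Fin L → Fin M → Matrix (Fin N) (Fin N) ℝ)
    (u : Fin L → Fin M → ℝ) (μ : Fin N → ℝ) :
    BddBelow (Set.range fun w : stdSimplex ℝ (Fin L) => fixedRisk σ Q u μ w.1) :=
  ⟨0, by rintro _ ⟨w, rfl⟩; exact fixedRisk_nonneg ..⟩

/-- The infimum over the simplex can be taken over a countable dense set of weights. -/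
theorem measurable_minFixedRisk [NeZero L] (hQ : ∀ l m, MeasurableEntries fun ω => Q ω l m)
    (hu : Measurable u) (hμ : Measurable μ) :
    Measurable fun ω => minFixedRisk σ (Q ω) (u ω) (μ ω) := by
  have hdense := TopologicalSpace.denseRange_denseSeq (stdSimplex ℝ (Fin L))
  refine measurable_of_Iio fun c => ?_
  have h : (fun ω => minFixedRisk σ (Q ω) (u ω) (μ ω)) ⁻¹' Set.Iio c
      = ⋃ i, {ω | fixedRisk σ (Q ω) (u ω) (μ ω)
        (TopologicalSpace.denseSeq (stdSimplex ℝ (Fin L)) i).1 < c} := by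
    ext ω
    simp only [Set.mem_preimage, Set.mem_Iio, minFixedRisk, Set.mem_iUnion, Set.mem_ofPred_eq]
    rw [ciInf_lt_iff (bddBelow_fixedRisk ..)]
    constructor
    · intro hw
      exact hdense.exists_mem_open (isOpen_lt ((continuous_fixedRisk σ (Q ω) (u ω) (μ ω)).comp
        continuous_subtype_val) continuous_const) hw
    · rintro ⟨i, hi⟩
      exact ⟨_, hi⟩
  rw [h]
  exact MeasurableSet.iUnion fun i =>
    measurableSet_lt (measurable_fixedRisk hQ hu hμ _) measurable_const

theorem measurable_centeredProd_comp (he : Measurable e) :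
    Measurable fun ω => centeredProd σ (e ω) :=
  measurable_pi_lambda _ fun p => (measurable_centeredProd σ p).comp he

theorem measurable_noiseEnergy (hQ : ∀ l m, MeasurableEntries fun ω => Q ω l m)
    (hu : Measurable u) (hμ : Measurable μ) (he : Measurable e) :
    Measurable fun ω => noiseEnergy σ (Q ω) (u ω) (μ ω) (e ω) := by
  have hG := measurableEntries_groupMat hQ hu
  have hb : ∀ l, Measurable fun ω => μ ω - groupMat (Q ω) (u ω) l *ᵥ μ ω :=
    fun l => hμ.sub ((hG l).mulVec hμ)
  have h1 : MeasurableEntries fun ω => biasColumns (Q ω) (u ω) (μ ω) :=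
    fun i l => (measurable_pi_apply i).comp (hb l)
  have h2 : MeasurableEntries fun ω => smoothedBiasColumns (Q ω) (u ω) (μ ω) :=
    fun i p => (measurable_pi_apply i).comp ((hG p.1).mulVec (hb p.2))
  have h3 : MeasurableEntries fun ω => vecColumns (groupMat (Q ω) (u ω)) :=
    fun p l => hG l p.1 p.2
  have h4 : MeasurableEntries fun ω => vecColumns fun p : Fin L × Fin L =>
      groupMat (Q ω) (u ω) p.1 * groupMat (Q ω) (u ω) p.2 :=
    fun p q => (hG q.1).mul (hG q.2) p.1 p.2
  have hc := measurable_centeredProd_comp (σ := σ) he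
  exact ((h1.spanEnergy he).add (h2.spanEnergy he)).add
    (((h3.spanEnergy hc).add (h4.spanEnergy hc)).div_const _)

theorem measurable_weightCross (hQ : ∀ l m, MeasurableEntries fun ω => Q ω l m)
    {d : Ω → Fin L → Fin M → ℝ} (hd : Measurable d) (hμ : Measurable μ) (he : Measurable e) :
    Measurable fun ω => weightCross σ (Q ω) (d ω) (μ ω) (e ω) := by
  have hdl : ∀ l, Measurable fun ω => sqNorm (d ω l) := fun l =>
    measurable_dotProduct ((measurable_pi_apply l).comp hd) ((measurable_pi_apply l).comp hd)
  refine Finset.measurable_sum _ fun l _ => ((hdl l).sqrt.mul ?_).add ((hdl l).sqrt.mul ?_)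
  · exact (Finset.measurable_sum _ fun m _ =>
      (measurable_dotProduct he ((hQ l m).mulVec hμ)).pow_const 2).sqrt
  · refine (Finset.measurable_sum _ fun m _ => Measurable.pow_const ?_ 2).sqrt
    refine (measurable_dotProduct he ((hQ l m).mulVec he)).sub (Measurable.const_mul ?_ _)
    exact Finset.measurable_sum _ fun i _ => hQ l m i i

theorem measurable_sqNorm_add (hμ : Measurable μ) (he : Measurable e) :
    Measurable fun ω => sqNorm (μ ω + e ω) :=
  measurable_dotProduct (hμ.add he) (hμ.add he)

end Measurability

/-! ### Conditioning on the design -/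

section Conditioning

variable {Ω : Type*} {m : MeasurableSpace Ω} {mΩ : MeasurableSpace Ω} [StandardBorelSpace Ω] {P : Measure Ω}
  [IsFiniteMeasure P]

theorem measurableSet_snd_eq_fst {α α' β : Type*} {m : MeasurableSpace α}
    {m' : MeasurableSpace α'} [MeasurableSpace β] [MeasurableEq β] {f : α → β} {g : α' → β}
    (hf : Measurable f) (hg : Measurable g) : MeasurableSet {p : α × α' | g p.2 = f p.1} :=
  measurableSet_eq_fun (hg.comp measurable_snd) (hf.comp measurable_fst)

/-- Under the conditional distribution given `m`, an `m`-measurable variable is almost surely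
constant. -/
theorem ae_condExpKernel_eq_const {β : Type*} [MeasurableSpace β] [MeasurableEq β]
    (hm : m ≤ mΩ) {f : Ω → β} (hf : Measurable[m] f) :
    ∀ᵐ ω ∂P, ∀ᵐ ω' ∂(condExpKernel P m ω), f ω' = f ω := by
  have hs : @MeasurableSet (Ω × Ω) (m.prod mΩ) {p : Ω × Ω | f p.2 = f p.1} :=
    measurableSet_snd_eq_fst hf (hf.mono hm le_rfl)
  have hdiag : @Measurable _ _ mΩ (m.prod mΩ) (Function.diag : Ω → Ω × Ω) :=
    Measurable.prodMk (measurable_id'' hm) measurable_id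
  have h : ∀ᵐ p ∂((P.trim hm) ⊗ₘ condExpKernel P m), f p.2 = f p.1 := by
    rw [compProd_trim_condExpKernel hm]
    refine (@ae_map_iff _ _ mΩ (m.prod mΩ) _ _
      (@Measurable.aemeasurable _ _ mΩ (m.prod mΩ) _ _ hdiag) _ hs).2 ?_
    exact Eventually.of_forall fun ω => rfl
  exact ae_of_ae_trim hm (Measure.ae_ae_of_ae_compProd h)

/-- If the conditional means of nonnegative variables tend to zero almost surely, then the variables
tend to zero in probability. -/
theorem tendsto_measure_of_condExpKernel [IsProbabilityMeasure P] {m : ℕ → MeasurableSpace Ω}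
    (hm : ∀ N, m N ≤ mΩ) {f : ℕ → Ω → ℝ} (hf : ∀ N, Measurable (f N))
    (h : ∀ᵐ ω ∂P, Tendsto (fun N => ∫⁻ ω', ENNReal.ofReal (f N ω') ∂(condExpKernel P (m N) ω))
      atTop (𝓝 0)) {δ : ℝ} (hδ : 0 < δ) :
    Tendsto (fun N => P {ω | δ ≤ f N ω}) atTop (𝓝 0) := by
  have hs : ∀ N, MeasurableSet {ω | δ ≤ f N ω} := fun N =>
    measurableSet_le measurable_const (hf N)
  have hk : ∀ N, Measurable fun ω => condExpKernel P (m N) ω {ω | δ ≤ f N ω} := fun N =>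
    (measurable_condExpKernel (hs N)).mono (hm N) le_rfl
  have hP : ∀ N, P {ω | δ ≤ f N ω} = ∫⁻ ω, condExpKernel P (m N) ω {ω | δ ≤ f N ω} ∂P := by
    intro N
    conv_lhs => rw [← condExpKernel_comp_trim (μ := P) (hm N)]
    rw [Measure.bind_apply (hs N) (Kernel.aemeasurable _), lintegral_trim]
    exact measurable_condExpKernel (hs N)
  simp only [hP]
  have hlim := tendsto_lintegral_of_dominated_convergence (μ := P)
    (F := fun N ω => condExpKernel P (m N) ω {ω | δ ≤ f N ω}) (f := fun _ => 0) (fun _ => 1) hk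
    (fun N => Eventually.of_forall fun ω => prob_le_one) (by simp) ?_
  · simpa using hlim
  filter_upwards [h] with ω hω
  have hδ0 : ENNReal.ofReal δ ≠ 0 := by simpa using hδ
  have h2 := ENNReal.Tendsto.div_const hω (b := ENNReal.ofReal δ) (Or.inr hδ0)
  rw [ENNReal.zero_div] at h2
  refine tendsto_of_tendsto_of_tendsto_of_le_of_le tendsto_const_nhds h2 (fun _ => zero_le) ?_
  intro N
  refine le_trans (measure_mono fun ω' hω' => ?_)
    (meas_ge_le_lintegral_div (hf N).ennreal_ofReal.aemeasurable hδ0 ENNReal.ofReal_ne_top)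
  exact ENNReal.ofReal_le_ofReal hω'

end Conditioning

/-! ### The relative remainder -/

section Remainder

variable {N L M : ℕ}

/-- The total remainder relative to the minimal risk. It is set to `1` if the minimal risk vanishes,
so that a remainder below `1` certifies that the minimal risk is positive. -/
noncomputable def relRemainder (σ : ℝ) (Q : Fin L → Fin M → Matrix (Fin N) (Fin N) ℝ)
    (u v : Fin L → Fin M → ℝ) (μ e : Fin N → ℝ) : ℝ :=
  if 0 < minFixedRisk σ Q u μ then
    (minFixedRisk σ Q u μ)⁻¹ * noiseEnergy σ Q u μ e
      + (minFixedRisk σ Q u μ)⁻¹ * weightCross σ Q (v - u) μ e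
      + (√(minFixedRisk σ Q u μ))⁻¹ * √(M * (∑ l, sqNorm ((v - u) l)) * sqNorm (μ + e))
  else 1

theorem noiseEnergy_nonneg (σ : ℝ) (Q : Fin L → Fin M → Matrix (Fin N) (Fin N) ℝ)
    (u : Fin L → Fin M → ℝ) (μ e : Fin N → ℝ) : 0 ≤ noiseEnergy σ Q u μ e :=
  add_nonneg (add_nonneg (spanEnergy_nonneg _ _) (spanEnergy_nonneg _ _))
    (div_nonneg (add_nonneg (spanEnergy_nonneg _ _) (spanEnergy_nonneg _ _)) (sq_nonneg _))

theorem weightCross_nonneg (σ : ℝ) (Q : Fin L → Fin M → Matrix (Fin N) (Fin N) ℝ)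
    (d : Fin L → Fin M → ℝ) (μ e : Fin N → ℝ) : 0 ≤ weightCross σ Q d μ e :=
  Finset.sum_nonneg fun l _ => by positivity

/-- On the event that the relative remainder is small, a minimizer of the Mallows criterion nearly
minimizes the loss. -/
theorem abs_loss_ratio_sub_one_le [NeZero L] {σ δ : ℝ}
    {Q : Fin L → Fin M → Matrix (Fin N) (Fin N) ℝ} (hQs : ∀ l m, (Q l m)ᵀ = Q l m)
    (hQc : ∀ l m, IsContraction (Q l m)) {u v : Fin L → Fin M → ℝ}
    (hu : ∀ l, u l ∈ stdSimplex ℝ (Fin M)) {μ e : Fin N → ℝ} (hσ : σ = 0 → e = 0)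
    (hδ : 0 < δ) (hδ1 : δ ≤ 1 / 32) (hrem : relRemainder σ Q u v μ e < δ ^ 2)
    {a : Fin L → ℝ} (ha : a ∈ stdSimplex ℝ (Fin L))
    (hmin : IsMinOn (fun w => sqNorm (μ + e - avgMat Q v w *ᵥ (μ + e))
      + 2 * σ ^ 2 * (avgMat Q v w).trace) (stdSimplex ℝ (Fin L)) a) :
    |sqNorm (avgMat Q v a *ᵥ (μ + e) - μ) / (⨅ w : stdSimplex ℝ (Fin L),
      sqNorm (avgMat Q v w.1 *ᵥ (μ + e) - μ)) - 1| ≤ 32 * δ := by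
  set ξ := minFixedRisk σ Q u μ with hξ
  have hpos : 0 < ξ := by
    by_contra hneg
    rw [relRemainder, if_neg hneg] at hrem
    nlinarith
  rw [relRemainder, if_pos hpos] at hrem
  have hD0 : 0 ≤ M * (∑ l, sqNorm ((v - u) l)) * sqNorm (μ + e) :=
    mul_nonneg (mul_nonneg (Nat.cast_nonneg M)
      (Finset.sum_nonneg fun l _ => dotProduct_self_nonneg_real _))
      (dotProduct_self_nonneg_real _)
  have n1 : 0 ≤ ξ⁻¹ * noiseEnergy σ Q u μ e :=
    mul_nonneg (inv_nonneg.2 hpos.le) (noiseEnergy_nonneg ..)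
  have n2 : 0 ≤ ξ⁻¹ * weightCross σ Q (v - u) μ e :=
    mul_nonneg (inv_nonneg.2 hpos.le) (weightCross_nonneg ..)
  have n3 : 0 ≤ (√ξ)⁻¹ * √(M * (∑ l, sqNorm ((v - u) l)) * sqNorm (μ + e)) := by positivity
  have hδ2 : δ ^ 2 ≤ δ := by nlinarith
  have b1 : noiseEnergy σ Q u μ e ≤ δ ^ 2 * ξ := by
    rw [mul_comm, ← inv_mul_le_iff₀ hpos]
    linarith
  have b2 : weightCross σ Q (v - u) μ e ≤ δ * ξ := by
    rw [mul_comm, ← inv_mul_le_iff₀ hpos]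
    linarith
  have b3 : M * (∑ l, sqNorm ((v - u) l)) * sqNorm (μ + e) ≤ δ ^ 2 * ξ := by
    have h1 : √(M * (∑ l, sqNorm ((v - u) l)) * sqNorm (μ + e)) ≤ δ * √ξ := by
      rw [mul_comm δ, ← inv_mul_le_iff₀ (Real.sqrt_pos.2 hpos)]
      linarith
    have h2 := pow_le_pow_left₀ (Real.sqrt_nonneg _) h1 2
    rwa [Real.sq_sqrt hD0, mul_pow, Real.sq_sqrt hpos.le] at h2
  have hle : ∀ w ∈ stdSimplex ℝ (Fin L), ξ ≤ fixedRisk σ Q u μ w := fun w hw =>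
    ciInf_le (bddBelow_fixedRisk σ Q u μ) (⟨w, hw⟩ : stdSimplex ℝ (Fin L))
  have hscale : ∀ w ∈ stdSimplex ℝ (Fin L), ∀ c : ℝ, 0 ≤ c →
      c * ξ ≤ c * fixedRisk σ Q u μ w :=
    fun w hw c hc => mul_le_mul_of_nonneg_left (hle w hw) hc
  have h := abs_div_iInf_sub_one_le (c := sqNorm e) (ξ := ξ) (η := 8 * δ) ha hpos (by positivity)
    (by linarith) hle
    (fun w hw => abs_loss_sub_fixedRisk_le (v := v) hQs hQc hu hw hδ.le (by linarith) hσ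
      (b1.trans (hscale w hw _ (sq_nonneg δ))) (b3.trans (hscale w hw _ (sq_nonneg δ))))
    (fun w hw => abs_mallows_sub_loss_le (v := v) hQc hu hw hδ.le hσ
      (b1.trans (hscale w hw _ (sq_nonneg δ))) (b2.trans (hscale w hw _ hδ.le))) hmin
  calc _ ≤ 4 * (8 * δ) := h
    _ = 32 * δ := by ring

/-- The mean of the relative remainder, in terms of the three rates. -/
theorem meanLe_relRemainder {Ω : Type*} [MeasurableSpace Ω] {ν : Measure Ω}
    [IsProbabilityMeasure ν] [NeZero L] {e : Ω → Fin N → ℝ} {σ κ : ℝ}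
    (h : WhiteNoise ν e σ κ) (hκ : 0 ≤ κ)
    {Q : Fin L → Fin M → Matrix (Fin N) (Fin N) ℝ} (hQc : ∀ l m, IsContraction (Q l m))
    (hQf : ∀ l m, frobSq (Q l m) ≤ N) {u : Fin L → Fin M → ℝ} {v : Ω → Fin L → Fin M → ℝ}
    (hv : Measurable v) {μ : Fin N → ℝ} {c C r : ℝ} (hC : 0 ≤ C) (hc : 0 ≤ c)
    (hμ : sqNorm μ ≤ c * N)
    (hdev : ∀ l, ∫⁻ ω, ENNReal.ofReal (sqNorm (v ω l - u l) ^ 2) ∂ν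
      ≤ ENNReal.ofReal (C * r ^ 4)) (hξ : 0 < minFixedRisk σ Q u μ) :
    MeanLe ν (fun ω => relRemainder σ Q u (v ω) μ (e ω))
      ((σ ^ 2 + 2 * κ) * 2 * ((minFixedRisk σ Q u μ)⁻¹ * (L : ℝ) ^ 2)
        + √(√C) * (√(σ ^ 2 * c) + √(2 * κ * σ ^ 2)) *
          |(minFixedRisk σ Q u μ)⁻¹ * (r * L * √((M : ℝ) * N))|
        + √(√C * (c + σ ^ 2)) * √((minFixedRisk σ Q u μ)⁻¹ * (r ^ 2 * L * M * N))) := by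
  set ξ := minFixedRisk σ Q u μ with hξdef
  have hξ0 : 0 ≤ ξ⁻¹ := inv_nonneg.2 hξ.le
  have hd : ∀ l, MeanLe ν (fun ω => sqNorm ((v ω - u) l)) (√C * r ^ 2) := by
    intro l
    have hm : Measurable fun ω => v ω l - u l :=
      ((measurable_pi_apply l).comp hv).sub measurable_const
    have h1 := meanLe_of_sq (measurable_dotProduct hm hm).aemeasurable
      (fun ω => dotProduct_self_nonneg_real _)
      (mul_nonneg hC (by positivity : 0 ≤ r ^ 4)) (hdev l)
    rw [Real.sqrt_mul hC, show r ^ 4 = (r ^ 2) ^ 2 by ring, Real.sqrt_sq (sq_nonneg r)] at h1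
    exact h1
  have m1 := (meanLe_noiseEnergy h hκ Q u μ).const_mul hξ0
  have m2 := (meanLe_weightCross h hκ hQc hQf μ hd).const_mul hξ0
  have m3 := (meanLe_sqrt_weightFit h μ hd).const_mul (inv_nonneg.2 (Real.sqrt_nonneg ξ))
  have hfun : (fun ω => relRemainder σ Q u (v ω) μ (e ω)) = fun ω =>
      ξ⁻¹ * noiseEnergy σ Q u μ (e ω) + ξ⁻¹ * weightCross σ Q (v ω - u) μ (e ω)
        + (√ξ)⁻¹ * √(M * (∑ l, sqNorm ((v ω - u) l)) * sqNorm (μ + e ω)) := by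
    funext ω
    rw [relRemainder, if_pos hξ]
  rw [hfun]
  refine ((m1.add m2).add m3).mono_right (add_le_add (add_le_add ?_ ?_) ?_)
  · have hL : (1 : ℝ) ≤ L := by exact_mod_cast NeZero.one_le
    have : (L : ℝ) + (L : ℝ) ^ 2 ≤ 2 * (L : ℝ) ^ 2 := by nlinarith
    calc ξ⁻¹ * ((σ ^ 2 + 2 * κ) * (L + (L : ℝ) ^ 2))
        ≤ ξ⁻¹ * ((σ ^ 2 + 2 * κ) * (2 * (L : ℝ) ^ 2)) := by gcongr
      _ = _ := by ring
  · have e1 : √(√C * r ^ 2) = √(√C) * |r| := by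
      rw [Real.sqrt_mul (Real.sqrt_nonneg C), Real.sqrt_sq_eq_abs]
    have e2 : √(M * (σ ^ 2 * sqNorm μ)) ≤ √(σ ^ 2 * c) * √((M : ℝ) * N) := by
      rw [← Real.sqrt_mul (by positivity)]
      refine Real.sqrt_le_sqrt ?_
      calc M * (σ ^ 2 * sqNorm μ) ≤ M * (σ ^ 2 * (c * N)) := by gcongr
        _ = _ := by ring
    have e3 : √(M * (2 * κ * σ ^ 2 * N)) = √(2 * κ * σ ^ 2) * √((M : ℝ) * N) := by
      rw [← Real.sqrt_mul (by positivity)]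
      congr 1
      ring
    have e4 : |ξ⁻¹ * (r * L * √((M : ℝ) * N))| = ξ⁻¹ * (|r| * L * √((M : ℝ) * N)) := by
      rw [abs_mul, abs_mul, abs_mul, abs_of_nonneg hξ0, abs_of_nonneg (Real.sqrt_nonneg _),
        Nat.abs_cast]
    rw [e1, e3, e4]
    calc _ ≤ ξ⁻¹ * (L * (√(√C) * |r| * (√(σ ^ 2 * c) * √((M : ℝ) * N))
          + √(√C) * |r| * (√(2 * κ * σ ^ 2) * √((M : ℝ) * N)))) := by gcongr
      _ = _ := by ring
  · rw [← Real.sqrt_inv, ← Real.sqrt_mul (by positivity), ← Real.sqrt_mul hξ0,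
      ← Real.sqrt_mul (by positivity)]
    refine Real.sqrt_le_sqrt ?_
    calc ξ⁻¹ * (M * (L * (√C * r ^ 2)) * (sqNorm μ + σ ^ 2 * N))
        ≤ ξ⁻¹ * (M * (L * (√C * r ^ 2)) * (c * N + σ ^ 2 * N)) := by gcongr
      _ = _ := by ring

theorem measurable_relRemainder {Ω : Type*} [MeasurableSpace Ω] [NeZero L] {σ : ℝ}
    {Q : Ω → Fin L → Fin M → Matrix (Fin N) (Fin N) ℝ}
    {u v : Ω → Fin L → Fin M → ℝ} {μ e : Ω → Fin N → ℝ}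
    (hQ : ∀ l m, MeasurableEntries fun ω => Q ω l m) (hu : Measurable u) (hv : Measurable v)
    (hμ : Measurable μ) (he : Measurable e) :
    Measurable fun ω => relRemainder σ (Q ω) (u ω) (v ω) (μ ω) (e ω) := by
  have hξ := measurable_minFixedRisk (σ := σ) hQ hu hμ
  have hd : Measurable fun ω => v ω - u ω := hv.sub hu
  have hdl : ∀ l, Measurable fun ω => sqNorm ((v ω - u ω) l) := fun l =>
    measurable_dotProduct ((measurable_pi_apply l).comp hd) ((measurable_pi_apply l).comp hd)
  refine Measurable.ite (measurableSet_lt measurable_const hξ) (Measurable.add (Measurable.add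
    (hξ.inv.mul (measurable_noiseEnergy hQ hu hμ he))
    (hξ.inv.mul (measurable_weightCross hQ hd hμ he))) (hξ.sqrt.inv.mul ?_)) measurable_const
  exact (((Finset.measurable_sum _ fun l _ => hdl l).const_mul _).mul
    (measurable_sqNorm_add hμ he)).sqrt

end Remainder

/-! ### The estimator with random design -/

section Design

variable {N K L M : ℕ}

/-- The projections of all candidate models. -/
noncomputable def designProj (X : Fin N → Fin K → ℝ) (S : Fin L → Fin M → Fin K → Bool)
    (l : Fin L) (m : Fin M) : Matrix (Fin N) (Fin N) ℝ :=
  modelProj X (S l m)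

theorem rsaFit_eq_mulVec (X : Fin N → Fin K → ℝ) (S : Fin L → Fin M → Fin K → Bool)
    (v : Fin L → Fin M → ℝ) (Y : Fin N → ℝ) (w : Fin L → ℝ) :
    rsaFit X S v Y w = avgMat (designProj X S) v w *ᵥ Y := by
  simp only [rsaFit, avgMat, groupMat, designProj, Matrix.sum_mulVec, Matrix.smul_mulVec]

theorem rsaLoss_eq (X : Fin N → Fin K → ℝ) (S : Fin L → Fin M → Fin K → Bool)
    (v : Fin L → Fin M → ℝ) (β : Fin K → ℝ) (ε : Fin N → ℝ) (w : Fin L → ℝ) :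
    rsaLoss X S v β ε w
      = sqNorm (avgMat (designProj X S) v w *ᵥ (regMean X β + ε) - regMean X β) := by
  rw [rsaLoss, rsaFit_eq_mulVec]

theorem rsaMallows_eq (σ : ℝ) (X : Fin N → Fin K → ℝ) (S : Fin L → Fin M → Fin K → Bool)
    (v : Fin L → Fin M → ℝ) (Y : Fin N → ℝ) (w : Fin L → ℝ) :
    rsaMallows σ X S v Y w = sqNorm (Y - avgMat (designProj X S) v w *ᵥ Y)
      + 2 * σ ^ 2 * (avgMat (designProj X S) v w).trace := by
  simp only [rsaMallows, rsaFit_eq_mulVec, avgMat, groupMat, designProj, modelDim,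
    Matrix.trace_sum, Matrix.trace_smul, smul_eq_mul]

theorem designProj_transpose (X : Fin N → Fin K → ℝ) (S : Fin L → Fin M → Fin K → Bool)
    (l : Fin L) (m : Fin M) : (designProj X S l m)ᵀ = designProj X S l m :=
  projMat_transpose _

theorem isContraction_designProj (X : Fin N → Fin K → ℝ) (S : Fin L → Fin M → Fin K → Bool)
    (l : Fin L) (m : Fin M) : IsContraction (designProj X S l m) :=
  isContraction_projMat _

theorem frobSq_designProj_le (X : Fin N → Fin K → ℝ) (S : Fin L → Fin M → Fin K → Bool)
    (l : Fin L) (m : Fin M) : frobSq (designProj X S l m) ≤ N := by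
  simpa [designProj, modelProj] using frobSq_projMat_le (Matrix.of X * selMat (S l m))

theorem measurable_regMean {Ω : Type*} [MeasurableSpace Ω] {X : Ω → Fin N → Fin K → ℝ}
    (hX : Measurable X) (β : Fin K → ℝ) : Measurable fun ω => regMean (X ω) β :=
  MeasurableEntries.mulVec (A := fun ω => Matrix.of (X ω))
    (fun i j => (measurable_pi_apply j).comp ((measurable_pi_apply i).comp hX)) measurable_const

variable {Ω : Type*} [MeasurableSpace Ω] [StandardBorelSpace Ω] {P : Measure Ω}
  [IsProbabilityMeasure P] {X : Ω → Fin N → Fin K → ℝ} {S : Ω → Fin L → Fin M → Fin K → Bool}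
  {u : Ω → Fin L → Fin M → ℝ}

/-- Given the design, the design is almost surely constant. -/
theorem ae_ae_design_eq (hX : Measurable X) (hS : Measurable S)
    (hu : Measurable[designAlg X S] u) :
    ∀ᵐ ω ∂P, ∀ᵐ ω' ∂(condExpKernel P (designAlg X S) ω),
      X ω' = X ω ∧ S ω' = S ω ∧ u ω' = u ω := by
  have hle : designAlg X S ≤ _ := (hX.prodMk hS).comap_le
  have hX' : Measurable[designAlg X S] X := measurable_fst.comp (comap_measurable _)
  have hS' : Measurable[designAlg X S] S := measurable_snd.comp (comap_measurable _)
  filter_upwards [ae_condExpKernel_eq_const (P := P) hle hX',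
    ae_condExpKernel_eq_const (P := P) hle hS', ae_condExpKernel_eq_const (P := P) hle hu]
    with ω h1 h2 h3
  filter_upwards [h1, h2, h3] with ω' e1 e2 e3
  exact ⟨e1, e2, e3⟩

/-- The conditional risk is the risk with the design held fixed, for all second-round weights
simultaneously. -/
theorem ae_minCondRisk_eq (hX : Measurable X) (hS : Measurable S)
    (hu : Measurable[designAlg X S] u) (β : Fin K → ℝ) {e : Ω → Fin N → ℝ} {σ κ : ℝ}
    (hnoise : ∀ᵐ ω ∂P, WhiteNoise (condExpKernel P (designAlg X S) ω) e σ κ) :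
    ∀ᵐ ω ∂P, minCondRisk P X S u β e ω
      = minFixedRisk σ (designProj (X ω) (S ω)) (u ω) (regMean (X ω) β) := by
  filter_upwards [ae_ae_design_eq (P := P) hX hS hu, hnoise] with ω hω hn
  refine iInf_congr fun w => ?_
  have hA := avgMat_transpose (designProj_transpose (X ω) (S ω)) (u ω) w.1
  rw [condRisk, fixedRisk, ← (hn.sqNorm_mulVec_sub hA _).2]
  refine integral_congr_ae ?_
  filter_upwards [hω] with ω' h
  rw [h.1, h.2.1, h.2.2, rsaLoss_eq, mulVec_add_sub_eq]

end Design

/-! ### Asymptotic optimality -/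

theorem theorem1
    {Ω : Type*} [MeasurableSpace Ω] [StandardBorelSpace Ω]
    (P : Measure Ω) [IsProbabilityMeasure P]
    -- numbers of covariates, groups and models per group, as functions of the sample size `N`
    (K L M : ℕ → ℕ) (hL : ∀ N, 0 < L N) (hM : ∀ N, 0 < M N)
    -- the homoscedastic linear model `Y = X β + e`
    (β : ∀ N, Fin (K N) → ℝ) (σ C₄ : ℝ)
    (X : ∀ N, Ω → Fin N → Fin (K N) → ℝ) (hX : ∀ N, Measurable (X N))
    (e : ∀ N, Ω → Fin N → ℝ) (he : ∀ N, Measurable (e N))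
    (he_mem : ∀ N i, MemLp (fun ω => e N ω i) 4 P)
    (he_mean : ∀ N i,
      P[fun ω => e N ω i | MeasurableSpace.comap (X N) inferInstance] =ᵐ[P] fun _ => 0)
    (he_var : ∀ N i,
      P[fun ω => e N ω i ^ 2 | MeasurableSpace.comap (X N) inferInstance] =ᵐ[P] fun _ => σ ^ 2)
    (he_fourth : ∀ N i,
      P[fun ω => e N ω i ^ 4 | MeasurableSpace.comap (X N) inferInstance] ≤ᵐ[P] fun _ => C₄)
    (he_indep : ∀ N, iCondIndepFun (MeasurableSpace.comap (X N) inferInstance)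
      (hX N).comap_le (fun i ω => e N ω i) P)
    (hmean : ∀ᵐ ω ∂P,
      (fun N => sqNorm (regMean (X N ω) (β N))) =O[atTop] fun N => (N : ℝ))
    -- the random selections, generated independently of the errors given `X`
    (S : ∀ N, Ω → Fin (L N) → Fin (M N) → Fin (K N) → Bool) (hS : ∀ N, Measurable (S N))
    (hS_indep : ∀ N, CondIndepFun (MeasurableSpace.comap (X N) inferInstance)
      (hX N).comap_le (S N) (e N) P)
    -- data-dependent first-round weights, and their data-independent limits
    (what : ∀ N, Ω → Fin (L N) → Fin (M N) → ℝ) (hwhat : ∀ N, Measurable (what N))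
    (hwhat_sum : ∀ N ω l, ∑ m, what N ω l m = 1)
    (wlim : ∀ N, Ω → Fin (L N) → Fin (M N) → ℝ)
    (hwlim : ∀ N, Measurable[designAlg (X N) (S N)] (wlim N))
    (hwlim_mem : ∀ N ω l, wlim N ω l ∈ stdSimplex ℝ (Fin (M N)))
    -- `E[‖ŵ^{(ℓ)} - w^{(ℓ)}‖⁴ | X, R] = O(r⁴)`, uniformly over the groups
    (r : ℕ → ℝ)
    (hdev : ∀ᵐ ω ∂P, ∃ C : ℝ, ∀ᶠ N in atTop, ∀ l,
      ∫⁻ ω', ENNReal.ofReal (sqNorm (what N ω' l - wlim N ω' l) ^ 2)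
        ∂(condExpKernel P (designAlg (X N) (S N)) ω) ≤ ENNReal.ofReal (C * r N ^ 4))
    -- the rate conditions on `ξ_N`
    (ξ : ℕ → Ω → ℝ) (hξ : ∀ N, ξ N = minCondRisk P (X N) (S N) (wlim N) (β N) (e N))
    (hξ_pos : ∀ᵐ ω ∂P, ∀ᶠ N in atTop, 0 < ξ N ω)
    (hrate₁ : ∀ᵐ ω ∂P,
      Tendsto (fun N => (ξ N ω)⁻¹ * (r N ^ 2 * L N * M N * N)) atTop (𝓝 0))
    (hrate₂ : ∀ᵐ ω ∂P,
      Tendsto (fun N => (ξ N ω)⁻¹ * (r N * L N * √((M N : ℝ) * N))) atTop (𝓝 0))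
    (hrate₃ : ∀ᵐ ω ∂P,
      Tendsto (fun N => (ξ N ω)⁻¹ * (L N : ℝ) ^ 2) atTop (𝓝 0))
    -- second-round weights that minimize the Mallows criterion
    (wsel : ∀ N, Ω → Fin (L N) → ℝ)
    (hwsel_mem : ∀ N, ∀ᵐ ω ∂P, wsel N ω ∈ stdSimplex ℝ (Fin (L N)))
    (hwsel_min : ∀ N, ∀ᵐ ω ∂P,
      IsMinOn (rsaMallows σ (X N ω) (S N ω) (what N ω) (regMean (X N ω) (β N) + e N ω))
        (stdSimplex ℝ (Fin (L N))) (wsel N ω)) :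
    TendstoInMeasure P
      (fun N ω => rsaLoss (X N ω) (S N ω) (what N ω) (β N) (e N ω) (wsel N ω) /
        ⨅ w : stdSimplex ℝ (Fin (L N)),
          rsaLoss (X N ω) (S N ω) (what N ω) (β N) (e N ω) w.1)
      atTop (fun _ => 1) := by
  have hLne : ∀ N, NeZero (L N) := fun N => ⟨(hL N).ne'⟩
  set κ : ℝ := σ ^ 2 + |C₄| / σ ^ 2 with hκ_def
  have hκ : 0 ≤ κ := by positivity
  have hle : ∀ N, designAlg (X N) (S N) ≤ _ := fun N => ((hX N).prodMk (hS N)).comap_le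
  have hwlim' : ∀ N, Measurable (wlim N) := fun N => (hwlim N).mono (hle N) le_rfl
  have herr : ∀ N, CondErrors P (hX N) (e N) σ C₄ := fun N =>
    ⟨he N, he_mem N, he_mean N, he_var N, he_fourth N, he_indep N⟩
  have hnoise : ∀ N, ∀ᵐ ω ∂P, WhiteNoise
      (condExpKernel P (designAlg (X N) (S N)) ω) (e N) σ κ := fun N =>
    (herr N).ae_whiteNoise (hS N) (hS_indep N)
  have hξ_eq : ∀ N, ∀ᵐ ω ∂P, ξ N ω = minFixedRisk σ (designProj (X N ω) (S N ω)) (wlim N ω)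
      (regMean (X N ω) (β N)) := by
    intro N
    rw [hξ N]
    exact ae_minCondRisk_eq (hX N) (hS N) (hwlim N) (β N) (hnoise N)
  set rem : ℕ → Ω → ℝ := fun N ω => relRemainder σ (designProj (X N ω) (S N ω)) (wlim N ω)
    (what N ω) (regMean (X N ω) (β N)) (e N ω) with hrem_def
  have hrem_meas : ∀ N, Measurable (rem N) := fun N =>
    measurable_relRemainder (fun l m => measurableEntries_modelProj (hX N)
      ((measurable_pi_apply m).comp ((measurable_pi_apply l).comp (hS N))))
      (hwlim' N) (hwhat N) (measurable_regMean (hX N) (β N)) (he N)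
  -- the conditional mean of the relative remainder given the design tends to zero
  have hrem_lim : ∀ᵐ ω ∂P, Tendsto (fun N => ∫⁻ ω', ENNReal.ofReal (rem N ω')
      ∂(condExpKernel P (designAlg (X N) (S N)) ω)) atTop (𝓝 0) := by
    filter_upwards [ae_all_iff.2 fun N => ae_ae_design_eq (P := P) (hX N) (hS N) (hwlim N),
      ae_all_iff.2 hnoise, ae_all_iff.2 hξ_eq, hmean, hdev, hξ_pos, hrate₁, hrate₂, hrate₃]
      with ω hdes hn hξω hm hd hpos h1 h2 h3
    obtain ⟨c, hc⟩ := hm.bound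
    obtain ⟨C, hC⟩ := hd
    have hlim : Tendsto (fun N =>
        (σ ^ 2 + 2 * κ) * 2 * ((ξ N ω)⁻¹ * (L N : ℝ) ^ 2)
        + √(√|C|) * (√(σ ^ 2 * |c|) + √(2 * κ * σ ^ 2)) *
          |(ξ N ω)⁻¹ * (r N * L N * √((M N : ℝ) * N))|
        + √(√|C| * (|c| + σ ^ 2)) * √((ξ N ω)⁻¹ * (r N ^ 2 * L N * M N * N))) atTop (𝓝 0) := by
      have t := ((h3.const_mul ((σ ^ 2 + 2 * κ) * 2)).add
        (h2.abs.const_mul (√(√|C|) * (√(σ ^ 2 * |c|) + √(2 * κ * σ ^ 2))))).add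
        (h1.sqrt.const_mul √(√|C| * (|c| + σ ^ 2)))
      simpa using t
    have hlim' := ENNReal.tendsto_ofReal hlim
    rw [ENNReal.ofReal_zero] at hlim'
    refine tendsto_of_tendsto_of_tendsto_of_le_of_le' tendsto_const_nhds hlim'
      (Eventually.of_forall fun _ => zero_le) ?_
    filter_upwards [hc, hC, hpos] with N hcN hCN hposN
    rw [hξω N] at hposN ⊢
    have hμ : sqNorm (regMean (X N ω) (β N)) ≤ |c| * N := by
      have h4 := (le_abs_self _).trans hcN
      rw [Real.norm_natCast] at h4
      exact h4.trans (mul_le_mul_of_nonneg_right (le_abs_self c) (Nat.cast_nonneg N))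
    have hdevN : ∀ l, ∫⁻ ω', ENNReal.ofReal (sqNorm (what N ω' l - wlim N ω l) ^ 2)
        ∂(condExpKernel P (designAlg (X N) (S N)) ω) ≤ ENNReal.ofReal (|C| * r N ^ 4) := by
      intro l
      have h5 : ∫⁻ ω', ENNReal.ofReal (sqNorm (what N ω' l - wlim N ω l) ^ 2)
          ∂(condExpKernel P (designAlg (X N) (S N)) ω)
          = ∫⁻ ω', ENNReal.ofReal (sqNorm (what N ω' l - wlim N ω' l) ^ 2)
          ∂(condExpKernel P (designAlg (X N) (S N)) ω) := by
        refine lintegral_congr_ae ?_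
        filter_upwards [hdes N] with ω' h6
        rw [h6.2.2]
      rw [h5]
      refine (hCN l).trans (ENNReal.ofReal_le_ofReal ?_)
      exact mul_le_mul_of_nonneg_right (le_abs_self C) (by positivity)
    have hmain := (meanLe_relRemainder (hn N) hκ (isContraction_designProj (X N ω) (S N ω))
      (frobSq_designProj_le (X N ω) (S N ω)) (hwhat N) (abs_nonneg C) (abs_nonneg c) hμ hdevN
      hposN).lintegral_le
    refine le_trans (le_of_eq (lintegral_congr_ae ?_)) hmain
    filter_upwards [hdes N] with ω' h6
    simp only [hrem_def, h6.1, h6.2.1, h6.2.2]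
  rw [tendstoInMeasure_iff_dist]
  intro ε hε
  -- the loss ratio deviates from `1` by at most `32 δ` if the relative remainder is below `δ²`
  set δ : ℝ := min (1 / 32) (ε / 64) with hδ_def
  have hδ : 0 < δ := by positivity
  have hδε : 32 * δ < ε := by
    have : δ ≤ ε / 64 := min_le_right _ _
    linarith
  have hlim := tendsto_measure_of_condExpKernel hle hrem_meas hrem_lim
    (show 0 < δ ^ 2 by positivity)
  refine tendsto_of_tendsto_of_tendsto_of_le_of_le tendsto_const_nhds hlim (fun _ => zero_le) ?_
  intro N
  refine measure_mono_ae ?_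
  have hzero : ∀ᵐ ω ∂P, σ = 0 → e N ω = 0 := by
    by_cases hσ : σ = 0
    · filter_upwards [(herr N).ae_eq_zero hσ] with ω hω _ using hω
    · exact Eventually.of_forall fun ω h => absurd h hσ
  filter_upwards [hwsel_mem N, hwsel_min N, hzero] with ω hmem hmin h0 hbad
  change δ ^ 2 ≤ rem N ω
  by_contra hsmall
  rw [not_le] at hsmall
  have hmin' : IsMinOn (fun w => sqNorm (regMean (X N ω) (β N) + e N ω
      - avgMat (designProj (X N ω) (S N ω)) (what N ω) w *ᵥ (regMean (X N ω) (β N) + e N ω))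
      + 2 * σ ^ 2 * (avgMat (designProj (X N ω) (S N ω)) (what N ω) w).trace)
      (stdSimplex ℝ (Fin (L N))) (wsel N ω) := by
    simpa only [← rsaMallows_eq] using hmin
  have hratio := abs_loss_ratio_sub_one_le (designProj_transpose (X N ω) (S N ω))
    (isContraction_designProj (X N ω) (S N ω)) (hwlim_mem N ω) h0 hδ (min_le_left _ _) hsmall
    hmem hmin'
  simp only [← rsaLoss_eq] at hratio
  have hbad' : ε ≤ dist _ (1 : ℝ) := hbad
  rw [Real.dist_eq] at hbad'
  linarith
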